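/- Notation. For $z\in\mathbb R^d$ and $\rho>0$ let $B_\rho(z)$ be the open Euclidean ball, $B_\rho=B_\rho(0)$, and let $\sigma$ be surface measure on spheres; $\fint$ denotes an average. For $p>1$ put $J_p(\xi)=|\xi|^{p-2}\xi$, $\Delta_p\phi=\nabla\cdot(|\nabla\phi|^{p-2}\nabla\phi)$, and, for $s\in(0,1)$, $$-(-\Delta)^s_p\phi(z)=\lim_{\varepsilon\to0^+}\int_{\mathbb R^d\setminus B_\varepsilon}J_p(\phi(z+y)-\phi(z))\frac{dy}{|y|^{d+sp}},\qquad \kappa_{p,d}=2\Big(\fint_{\partial B_1}|y_1|^p\,d\sigma(y)\Big)^{-1},$$ $$\mathcal M^p_{r,1}[\phi](z)=\frac{\kappa_{p,d}}{r^p}\fint_{\partial B_r}J_p(\phi(z+y)-\phi(z))\,d\sigma(y),\qquad \mathcal M^p_{r,2}[\phi](z)=\frac{(p+d)\kappa_{p,d}}{d\,r^p}\fint_{B_r}J_p(\phi(z+y)-\phi(z))\,dy,$$ $$\mathcal M^{s,p}_r[\phi](z)=\frac{p+d}{p(1-s)r^{d+sp}}\int_{B_r}J_p(\phi(z+y)-\phi(z))\,dy+\int_{\mathbb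 R^d\setminus B_r}J_p(\phi(z+y)-\phi(z))\frac{dy}{|y|^{d+sp}}.$$ Theorem. Let $d\ge2$, $p>1$, $s\in(0,1)$, $x\in\mathbb R^d$, $0<R<1$. Let $\phi:\mathbb R^d\to\mathbb R$ be of class $C^4$ on $B_R(x)$ with all derivatives of orders $0,\dots,4$ bounded there, and assume that $\nabla\phi$ (extended continuously to $\overline{B_R(x)}$) vanishes nowhere on $\overline{B_R(x)}$. Put $$R_0=\frac{\inf_{B_R(x)}|\nabla\phi|}{\sqrt2\,\|D^2\phi\|_{L^\infty(B_R(x))}}$$ (the Hessian being measured in operator norm, and $R_0=+\infty$ if $D^2\phi\equiv0$ on $B_R(x)$) and $\tilde R=\min\{R_0,R/2\}$. Let $\gamma=2$ if $p=2$ or $p\ge3$; let $\gamma$ be any number in $(1,p-1)$ if $p\in(2,3)$, and any number in $(0,p-1)$ if $p\in(1,2)$. 1. There is a constant $C$ such that for all $0<r<\tilde R$, all $z\in B_{\tilde R/2}(x)$ and $i=1,2$, $$|\Delta_p\phi(z)-\mathcal M^p_{r,i}[\phi](z)|\le C r^{\gamma}.$$ 2. If additionally $\phi\in L^\infty(\mathbb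 R^d)$, then for every $z\in B_{\tilde R/2}(x)$ the truncated integrals defining $-(-\Delta)^s_p\phi(z)$ converge absolutely and their limit exists, and there is a constant $C$ such that for all $0<r<\tilde R$ and all $z\in B_{\tilde R/2}(x)$, $$|-(-\Delta)^s_p\phi(z)-\mathcal M^{s,p}_r[\phi](z)|\le C r^{\gamma+p(1-s)}.$$ -/

import Mathlib

open MeasureTheory Metric Set Filter
open scoped Topology ENNReal

noncomputable section

namespace PLaplaceExpansion

/-- `J_p(ξ) = |ξ|^(p-2) ξ`. -/
def J (p ξ : ℝ) : ℝ := |ξ| ^ (p - 2) * ξ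

/-- `φ ∈ C_b^k(Ω)` for an open set `Ω`: `φ` is of class `C^k` on `Ω` and its derivatives of orders
`0, …, k` are bounded on `Ω`. -/
def IsCb {d : ℕ} (k : ℕ) (φ : EuclideanSpace ℝ (Fin d) → ℝ)
    (Ω : Set (EuclideanSpace ℝ (Fin d))) : Prop :=
  ContDiffOn ℝ k φ Ω ∧ ∀ j ≤ k, ∃ C : ℝ, ∀ z ∈ Ω, ‖iteratedFDeriv ℝ j φ z‖ ≤ C

/-- The divergence `∑ i, ∂_i F_i` of a vector field. -/
def divergence {d : ℕ} (F : EuclideanSpace ℝ (Fin d) → EuclideanSpace ℝ (Fin d))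
    (z : EuclideanSpace ℝ (Fin d)) : ℝ :=
  ∑ i : Fin d, fderiv ℝ F z (EuclideanSpace.single i 1) i

/-- The `p`-Laplacian `Δ_p φ = div (|∇φ|^(p-2) ∇φ)`. -/
def pLaplacian {d : ℕ} (p : ℝ) (φ : EuclideanSpace ℝ (Fin d) → ℝ)
    (z : EuclideanSpace ℝ (Fin d)) : ℝ :=
  divergence (fun w => ‖gradient φ w‖ ^ (p - 2) • gradient φ w) z

/-- The average of `f` over the sphere `∂B_r` (centred at the origin) with respect to the surface
measure. It is computed by rescaling to the unit sphere. -/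
def sphereAverage {d : ℕ} (r : ℝ) (f : EuclideanSpace ℝ (Fin d) → ℝ) : ℝ :=
  ⨍ ω : sphere (0 : EuclideanSpace ℝ (Fin d)) 1, f (r • (ω : EuclideanSpace ℝ (Fin d)))
    ∂(volume : Measure (EuclideanSpace ℝ (Fin d))).toSphere

/-- `κ_{p,d} = 2 (⨍_{∂B_1} |y_1|^p dσ)⁻¹`; the first coordinate has index `0`. -/
def kappa (p : ℝ) (d : ℕ) [NeZero d] : ℝ :=
  2 * (sphereAverage 1 fun y : EuclideanSpace ℝ (Fin d) => |y 0| ^ p)⁻¹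

/-- The spherical expansion `M^p_{r,1}` of the `p`-Laplacian. -/
def meanSphere {d : ℕ} [NeZero d] (p r : ℝ) (φ : EuclideanSpace ℝ (Fin d) → ℝ)
    (z : EuclideanSpace ℝ (Fin d)) : ℝ :=
  kappa p d / r ^ p * sphereAverage r fun y => J p (φ (z + y) - φ z)

/-- The solid expansion `M^p_{r,2}` of the `p`-Laplacian. -/
def meanBall {d : ℕ} [NeZero d] (p r : ℝ) (φ : EuclideanSpace ℝ (Fin d) → ℝ)
    (z : EuclideanSpace ℝ (Fin d)) : ℝ :=
  (p + d) * kappa p d / (d * r ^ p) *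
    ⨍ y in ball (0 : EuclideanSpace ℝ (Fin d)) r, J p (φ (z + y) - φ z)

/-- The integrand `J_p(φ(z+y) - φ(z)) / |y|^(d+sp)`. -/
def fracIntegrand {d : ℕ} (s p : ℝ) (φ : EuclideanSpace ℝ (Fin d) → ℝ)
    (z y : EuclideanSpace ℝ (Fin d)) : ℝ :=
  J p (φ (z + y) - φ z) / ‖y‖ ^ (d + s * p)

/-- The expansion `M^{s,p}_r` of the fractional `p`-Laplacian. -/
def meanFrac {d : ℕ} (s p r : ℝ) (φ : EuclideanSpace ℝ (Fin d) → ℝ)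
    (z : EuclideanSpace ℝ (Fin d)) : ℝ :=
  (p + d) / (p * (1 - s) * r ^ (d + s * p)) *
      (∫ y in ball (0 : EuclideanSpace ℝ (Fin d)) r, J p (φ (z + y) - φ z)) +
    ∫ y in (ball (0 : EuclideanSpace ℝ (Fin d)) r)ᶜ, fracIntegrand s p φ z y

/-- `L = -(-Δ)^s_p φ(z)`, i.e. the principal value
`lim_{ε → 0+} ∫_{|y| ≥ ε} J_p(φ(z+y) - φ(z)) / |y|^(d+sp) dy` exists and is `L`, all the truncated
integrals being absolutely convergent. -/
def HasNegFracPLaplacian {d : ℕ} (s p : ℝ) (φ : EuclideanSpace ℝ (Fin d) → ℝ)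
    (z : EuclideanSpace ℝ (Fin d)) (L : ℝ) : Prop :=
  (∀ ε > 0, IntegrableOn (fracIntegrand s p φ z)
    (ball (0 : EuclideanSpace ℝ (Fin d)) ε)ᶜ) ∧
  Tendsto (fun ε : ℝ => ∫ y in (ball (0 : EuclideanSpace ℝ (Fin d)) ε)ᶜ, fracIntegrand s p φ z y)
    (𝓝[>] 0) (𝓝 L)

/-- `R₀ = inf_{B_R(x)} |∇φ| / (√2 ‖D²φ‖_{L^∞(B_R(x))})`, with value `∞` when `D²φ = 0` and the
gradient does not vanish. The Hessian is measured in operator norm. -/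
def R0 {d : ℕ} (φ : EuclideanSpace ℝ (Fin d) → ℝ) (x : EuclideanSpace ℝ (Fin d)) (R : ℝ) : ℝ≥0∞ :=
  (⨅ z ∈ ball x R, ‖gradient φ z‖ₑ) /
    (ENNReal.ofReal (Real.sqrt 2) * eLpNorm (iteratedFDeriv ℝ 2 φ) ⊤ (volume.restrict (ball x R)))

/-- `min {R₀, R/2}`, a real number. -/
def Rtilde {d : ℕ} (φ : EuclideanSpace ℝ (Fin d) → ℝ) (x : EuclideanSpace ℝ (Fin d)) (R : ℝ) : ℝ :=
  (min (R0 φ x R) (ENNReal.ofReal (R / 2))).toReal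

/-- The admissible orders `γ` for the exponent `p`. -/
def AdmissibleOrder (p γ : ℝ) : Prop :=
  ((p = 2 ∨ 3 ≤ p) ∧ γ = 2) ∨
  ((2 < p ∧ p < 3) ∧ γ ∈ Ioo 1 (p - 1)) ∨
  ((1 < p ∧ p < 2) ∧ γ ∈ Ioo 0 (p - 1))

end PLaplaceExpansion

end

noncomputable section

namespace PLaplaceExpansion

/-! ### Polar coordinates on a finite-dimensional space. -/

section Polar

open Module

variable {E : Type*} [NormedAddCommGroup E] [NormedSpace ℝ E] [MeasurableSpace E] [BorelSpace E]
  [FiniteDimensional ℝ E] (μ : Measure E) [μ.IsAddHaarMeasure]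

/-! Everything rests on one estimate on spheres, `exists_sphere_estimate`: the average of J_p(φ(z+y)
- φ(z)) over ∂B_r equals r^p Δ_pφ(z)/κ + O(r^(p+γ)), uniformly in z.

Main term. Pair ω with -ω and write φ(z ± rω) - φ(z) = ±r(m ± δ), so that the pair contributes
r^(p-1) (J_p(m+δ) - J_p(m-δ)). With u = ∇φ(z)·ω and q = D²φ(z)(ω,ω), Taylor expansion along the line
gives m = u + O(r²) and 2δ = rq + O(r³), so the expected value of the bracket is (p-1)|u|^(p-2) r q.
By `sphere_integral_main` its integral over the sphere is a multiple of Δ_pφ(z): after rotating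
∇φ(z) to the first axis, only the moments of ω_i ω_j against |ω_0|^(p-2) enter. They vanish off the
diagonal, and the (0,0) moment is p-1 times the other diagonal ones, as Gaussian integrals show.

Error term. J_p need not be smooth at 0, so directions with small u are the difficulty. Where |u| >
4Kr, Taylor expansion of the power bounds the error by r³|u|^(p-4); where |u| ≤ 4Kr, sizes alone
give r^(p-1) + r|u|^(p-2). Both are at most a multiple of r^(γ+1)(1 + |u|^(p-2-γ)), whose
singularity is integrable over the sphere when γ < p-1. The lower bound on |∇φ| makes this uniform
in z. For p = 2 the function J_p is linear. For p = 3, where γ = p-1 is claimed, the error is O(r³)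
off the strip |u| ≤ 4Kr and O(r²) on it, and the strip has measure O(r).

The remaining work is radial: the estimate is integrated against t^(d-1) for balls and against
t^(-1-sp) for the fractional kernel. The normalising constants of the means are those for which the
leading terms agree. -/

theorem integral_volumeIoiPow (n : ℕ) (f : ℝ → ℝ) :
    ∫ t : Ioi (0 : ℝ), f t ∂(Measure.volumeIoiPow n) = ∫ t in Ioi (0 : ℝ), t ^ n * f t := by
  simp only [Measure.volumeIoiPow, ENNReal.ofReal]
  rw [integral_withDensity_eq_integral_smul,
    integral_subtype_comap measurableSet_Ioi fun a ↦ Real.toNNReal (a ^ n) • f a,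
    setIntegral_congr_fun measurableSet_Ioi fun x hx ↦ ?_]
  · rw [NNReal.smul_def, Real.coe_toNNReal _ (pow_nonneg hx.out.le _), smul_eq_mul]
  · exact (measurable_subtype_coe.pow_const _).real_toNNReal

theorem integrable_volumeIoiPow {n : ℕ} {f : ℝ → ℝ} :
    Integrable (fun t : Ioi (0 : ℝ) => f t) (Measure.volumeIoiPow n) ↔
      IntegrableOn (fun t => t ^ n * f t) (Ioi (0 : ℝ)) := by
  rw [integrableOn_iff_comap_subtypeVal measurableSet_Ioi, Measure.volumeIoiPow,
    integrable_withDensity_iff_integrable_smul', integrable_congr]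
  · refine .of_forall ?_
    rintro ⟨x, hx : 0 < x⟩
    simp (disch := positivity) [ENNReal.toReal_ofReal]
  · fun_prop
  · simp

/-- Polar coordinates, without any integrability assumption. -/
theorem integral_eq_integral_sphere_prod [Nontrivial E] (f : E → ℝ) :
    ∫ y, f y ∂μ = ∫ q : sphere (0 : E) 1 × Ioi (0 : ℝ), f ((q.2 : ℝ) • (q.1 : E))
      ∂(μ.toSphere.prod (Measure.volumeIoiPow (finrank ℝ E - 1))) := by
  calc
    ∫ y, f y ∂μ = ∫ y : ({(0)}ᶜ : Set E), f y ∂(μ.comap (↑)) := by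
      rw [integral_subtype_comap (measurableSet_singleton _).compl fun x ↦ f x,
        restrict_compl_singleton]
    _ = _ := by
      rw [← μ.measurePreserving_homeomorphUnitSphereProd.integral_comp
        (Homeomorph.measurableEmbedding _)]
      refine integral_congr_ae (.of_forall fun y => ?_)
      have hy : ‖(y : E)‖ ≠ 0 := norm_ne_zero_iff.2 y.2
      simp [smul_smul, hy]

theorem integrable_sphere_prod_iff [Nontrivial E] {f : E → ℝ} :
    Integrable (fun q : sphere (0 : E) 1 × Ioi (0 : ℝ) => f ((q.2 : ℝ) • (q.1 : E)))
      (μ.toSphere.prod (Measure.volumeIoiPow (finrank ℝ E - 1))) ↔ Integrable f μ := by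
  rw [← μ.measurePreserving_homeomorphUnitSphereProd.integrable_comp_emb
    (Homeomorph.measurableEmbedding _)]
  have h : Integrable f μ ↔ IntegrableOn f ({(0)}ᶜ : Set E) μ := by
    rw [IntegrableOn, restrict_compl_singleton]
  rw [h, integrableOn_iff_comap_subtypeVal (measurableSet_singleton _).compl]
  refine integrable_congr (.of_forall fun y => ?_)
  have hy : ‖(y : E)‖ ≠ 0 := norm_ne_zero_iff.2 y.2
  simp [smul_smul, hy]

theorem integral_eq_integral_Ioi_integral_sphere [Nontrivial E] {f : E → ℝ} (hf : Integrable f μ) :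
    ∫ y, f y ∂μ = ∫ t in Ioi (0 : ℝ), t ^ (finrank ℝ E - 1) *
      ∫ ω : sphere (0 : E) 1, f (t • (ω : E)) ∂μ.toSphere := by
  rw [integral_eq_integral_sphere_prod μ f,
    integral_prod_symm _ ((integrable_sphere_prod_iff μ).2 hf)]
  exact integral_volumeIoiPow _ fun t => ∫ ω : sphere (0 : E) 1, f (t • (ω : E)) ∂μ.toSphere

theorem integrableOn_Ioi_integral_sphere [Nontrivial E] {f : E → ℝ} (hf : Integrable f μ) :
    IntegrableOn (fun t => t ^ (finrank ℝ E - 1) *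
      ∫ ω : sphere (0 : E) 1, f (t • (ω : E)) ∂μ.toSphere) (Ioi (0 : ℝ)) :=
  integrable_volumeIoiPow.1 ((integrable_sphere_prod_iff μ).2 hf).integral_prod_right

end Polar

/-! ### Rotation invariance of surface measure. -/

section Rotation

variable {E : Type*} [NormedAddCommGroup E] [InnerProductSpace ℝ E]

/-- The restriction of a linear isometric equivalence to the unit sphere. -/
def sphereHomeomorph (L : E ≃ₗᵢ[ℝ] E) : sphere (0 : E) 1 ≃ₜ sphere (0 : E) 1 :=
  L.toHomeomorph.subtype fun y => by simp

@[simp]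
theorem coe_sphereHomeomorph (L : E ≃ₗᵢ[ℝ] E) (ω : sphere (0 : E) 1) :
    (sphereHomeomorph L ω : E) = L ω := rfl

variable [MeasurableSpace E] [BorelSpace E] [FiniteDimensional ℝ E]

open scoped Pointwise in
-- Surface measure is a multiple of the volume of the cone over a set; a linear isometry carries
-- cones to cones and preserves volume.
theorem measurePreserving_sphereHomeomorph (L : E ≃ₗᵢ[ℝ] E) :
    MeasurePreserving (sphereHomeomorph L) (volume : Measure E).toSphere
      (volume : Measure E).toSphere := by
  refine ⟨(sphereHomeomorph L).measurable, ?_⟩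
  ext t ht
  rw [Measure.map_apply (sphereHomeomorph L).measurable ht, Measure.toSphere_apply' _ ht,
    Measure.toSphere_apply' _ ((sphereHomeomorph L).measurable ht)]
  congr 1
  have : Ioo (0 : ℝ) 1 • ((↑) '' (sphereHomeomorph L ⁻¹' t) : Set E) =
      L ⁻¹' (Ioo (0 : ℝ) 1 • ((↑) '' t)) := by
    ext y
    simp only [Set.mem_smul, mem_image, mem_preimage]
    constructor
    · rintro ⟨a, ha, _, ⟨ω, hω, rfl⟩, rfl⟩
      exact ⟨a, ha, L ω, ⟨_, hω, rfl⟩, by simp⟩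
    · rintro ⟨a, ha, _, ⟨ω, hω, rfl⟩, h⟩
      refine ⟨a, ha, (sphereHomeomorph L).symm ω, ⟨_, by simpa using hω, rfl⟩, ?_⟩
      apply L.injective
      rw [← h, map_smul, ← coe_sphereHomeomorph, Homeomorph.apply_symm_apply]
  rw [this, L.measurePreserving.measure_preimage_emb L.toHomeomorph.measurableEmbedding]

theorem integral_sphere_comp (L : E ≃ₗᵢ[ℝ] E) (f : E → ℝ) :
    ∫ ω : sphere (0 : E) 1, f (L ω) ∂(volume : Measure E).toSphere =
      ∫ ω : sphere (0 : E) 1, f ω ∂(volume : Measure E).toSphere :=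
  (measurePreserving_sphereHomeomorph L).integral_comp
    (sphereHomeomorph L).measurableEmbedding (fun ω => f ω)

theorem integrable_sphere_comp (L : E ≃ₗᵢ[ℝ] E) {f : E → ℝ} :
    Integrable (fun ω : sphere (0 : E) 1 => f (L ω)) (volume : Measure E).toSphere ↔
      Integrable (fun ω : sphere (0 : E) 1 => f ω) (volume : Measure E).toSphere :=
  (measurePreserving_sphereHomeomorph L).integrable_comp_emb
    (sphereHomeomorph L).measurableEmbedding (g := fun ω => f ω)

end Rotation

/-! ### Adapted coordinates and the measure of equatorial strips. -/

section Coordinates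

variable {d : ℕ} [NeZero d]

theorem exists_orthonormalBasis_zero {v : EuclideanSpace ℝ (Fin d)} (hv : v ≠ 0) :
    ∃ b : OrthonormalBasis (Fin d) ℝ (EuclideanSpace ℝ (Fin d)), b 0 = ‖v‖⁻¹ • v := by
  have h1 : Orthonormal ℝ (({0} : Set (Fin d)).domRestrict
      fun _ : Fin d => (‖v‖⁻¹ • v : EuclideanSpace ℝ (Fin d))) := by
    refine ⟨fun i => ?_, fun i j hij => absurd (Subsingleton.elim i j) hij⟩
    simp [Set.domRestrict, norm_smul, hv]
  obtain ⟨b, hb⟩ := h1.exists_orthonormalBasis_extension_of_card_eq (by simp)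
  exact ⟨b, hb 0 rfl⟩

/-- Used with v = ∇φ(z): together with rotation invariance it turns sphere integrals of functions of
v·ω into integrals in the first coordinate. -/
theorem exists_linearIsometryEquiv_inner {v : EuclideanSpace ℝ (Fin d)} (hv : v ≠ 0) :
    ∃ L : EuclideanSpace ℝ (Fin d) ≃ₗᵢ[ℝ] EuclideanSpace ℝ (Fin d),
      ∀ ω, inner ℝ v (L ω) = ‖v‖ * ω 0 := by
  obtain ⟨b, hb⟩ := exists_orthonormalBasis_zero hv
  refine ⟨b.repr.symm, fun ω => ?_⟩
  have h : v = ‖v‖ • b 0 := by simp [hb, smul_smul, hv]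
  conv_lhs => rw [h]
  rw [real_inner_smul_left, ← OrthonormalBasis.repr_apply_apply, LinearIsometryEquiv.apply_symm_apply]

open scoped Pointwise in
-- The cone over the strip lies in a box of side 2ε in the first direction and 2 in the others, and
-- surface measure is d times the volume of the cone. The case ε = 0 shows that the equator is null;
-- positive ε is needed for p = 3.
theorem toSphere_abs_coord_le {ε : ℝ} (hε : 0 ≤ ε) :
    (volume : Measure (EuclideanSpace ℝ (Fin d))).toSphere
      {ω : sphere (0 : EuclideanSpace ℝ (Fin d)) 1 |
        |(ω : EuclideanSpace ℝ (Fin d)) 0| ≤ ε} ≤ ENNReal.ofReal (d * 2 ^ d * ε) := by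
  have hm : MeasurableSet {ω : sphere (0 : EuclideanSpace ℝ (Fin d)) 1 |
      |(ω : EuclideanSpace ℝ (Fin d)) 0| ≤ ε} := by
    refine (isClosed_le ?_ continuous_const).measurableSet
    fun_prop
  rw [Measure.toSphere_apply' _ hm, finrank_euclideanSpace_fin]
  let B : Set (Fin d → ℝ) := univ.pi fun i => if i = 0 then Icc (-ε) ε else Icc (-1) 1
  have hB : volume B ≤ ENNReal.ofReal (2 ^ d * ε) := by
    rw [volume_pi_pi, ← Finset.mul_prod_erase _ _ (Finset.mem_univ (0 : Fin d)),
      Finset.prod_congr rfl (g := fun _ => (2 : ℝ≥0∞))]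
    · have hd : 1 ≤ d := NeZero.one_le
      obtain ⟨n, rfl⟩ := Nat.exists_eq_add_of_le' hd
      simp only [Finset.prod_const, Finset.card_erase_of_mem (Finset.mem_univ _), Finset.card_univ,
        Fintype.card_fin, if_true, Real.volume_Icc, Nat.add_sub_cancel]
      rw [show (2 : ℝ≥0∞) ^ n = ENNReal.ofReal (2 ^ n) by
        rw [ENNReal.ofReal_pow (by norm_num)]; norm_num,
        ← ENNReal.ofReal_mul (by linarith)]
      apply ENNReal.ofReal_le_ofReal
      ring_nf; rfl
    · intro i hi
      rw [if_neg (Finset.ne_of_mem_erase hi), Real.volume_Icc]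
      norm_num
  have hsub : Ioo (0 : ℝ) 1 • ((↑) '' {ω : sphere (0 : EuclideanSpace ℝ (Fin d)) 1 |
      |(ω : EuclideanSpace ℝ (Fin d)) 0| ≤ ε} : Set (EuclideanSpace ℝ (Fin d))) ⊆
      WithLp.ofLp ⁻¹' B := by
    rintro _ ⟨a, ha, _, ⟨ω, hω, rfl⟩, rfl⟩
    intro i _
    have h1 : |(ω : EuclideanSpace ℝ (Fin d)) i| ≤ 1 := by
      have := PiLp.norm_apply_le (ω : EuclideanSpace ℝ (Fin d)) i
      simpa using this
    have key : ∀ c : ℝ, |(ω : EuclideanSpace ℝ (Fin d)) i| ≤ c →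
        a * (ω : EuclideanSpace ℝ (Fin d)) i ∈ Icc (-c) c := by
      intro c hc
      rw [mem_Icc, ← abs_le, abs_mul, abs_of_pos ha.1]
      exact (mul_le_of_le_one_left (abs_nonneg _) ha.2.le).trans hc
    change a * (ω : EuclideanSpace ℝ (Fin d)) i ∈ if i = 0 then Icc (-ε) ε else Icc (-1) 1
    by_cases hi : i = 0
    · subst hi
      rw [if_pos rfl]; exact key _ hω
    · rw [if_neg hi]; exact key _ h1
  calc _ ≤ (d : ℝ≥0∞) * volume (WithLp.ofLp ⁻¹' B : Set (EuclideanSpace ℝ (Fin d))) := by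
        gcongr
    _ = d * volume B := by
        rw [(PiLp.volume_preserving_ofLp (Fin d)).measure_preimage_emb
          (MeasurableEquiv.toLp 2 (Fin d → ℝ)).symm.measurableEmbedding]
    _ ≤ d * ENNReal.ofReal (2 ^ d * ε) := by gcongr
    _ = _ := by
        rw [mul_assoc, ENNReal.ofReal_mul (Nat.cast_nonneg d), ENNReal.ofReal_natCast]

theorem ae_toSphere_coord_ne_zero :
    ∀ᵐ ω : sphere (0 : EuclideanSpace ℝ (Fin d)) 1 ∂(volume : Measure (EuclideanSpace ℝ (Fin d))).toSphere,
      (ω : EuclideanSpace ℝ (Fin d)) 0 ≠ 0 := by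
  rw [ae_iff]
  have := toSphere_abs_coord_le (d := d) le_rfl
  simpa using this

end Coordinates

/-! ### Gaussian integrals of homogeneous functions. -/

section Gaussian

theorem integral_abs_rpow_mul_exp {q : ℝ} (hq : -1 < q) :
    ∫ x : ℝ, |x| ^ q * Real.exp (-x ^ 2) = Real.Gamma ((q + 1) / 2) := by
  have h1 : ∀ x : ℝ, |x| ^ q * Real.exp (-x ^ 2) =
      (fun t : ℝ => t ^ q * Real.exp (-1 * t ^ (2 : ℝ))) |x| := fun x => by simp
  simp_rw [h1]
  rw [integral_comp_abs (f := fun t : ℝ => t ^ q * Real.exp (-1 * t ^ (2 : ℝ))),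
    integral_rpow_mul_exp_neg_mul_rpow two_pos hq one_pos]
  simp

theorem integrable_abs_rpow_mul_exp {q : ℝ} (hq : -1 < q) :
    Integrable fun x : ℝ => |x| ^ q * Real.exp (-x ^ 2) := by
  -- A non-integrable function has integral 0 by convention, so the positive Gamma value already
  -- proves integrability.
  refine Integrable.of_integral_ne_zero ?_
  rw [integral_abs_rpow_mul_exp hq]
  exact (Real.Gamma_pos_of_pos (by linarith)).ne'

theorem integral_mul_exp_neg_sq : ∫ x : ℝ, x * Real.exp (-x ^ 2) = 0 := by
  have h := integral_neg_eq_self (fun x : ℝ => x * Real.exp (-x ^ 2)) volume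
  simp only [neg_mul, even_two, Even.neg_pow, integral_neg] at h
  linarith

variable {d : ℕ}

theorem exp_neg_norm_sq (y : EuclideanSpace ℝ (Fin d)) :
    Real.exp (-‖y‖ ^ 2) = ∏ i, Real.exp (-(y i) ^ 2) := by
  rw [EuclideanSpace.real_norm_sq_eq, ← Finset.sum_neg_distrib, Real.exp_sum]

theorem integral_prod_coord (f : Fin d → ℝ → ℝ) :
    ∫ y : EuclideanSpace ℝ (Fin d), ∏ i, f i (y i) = ∏ i, ∫ t, f i t := by
  rw [← integral_fintype_prod_volume_eq_prod f]
  exact (PiLp.volume_preserving_ofLp (Fin d)).integral_comp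
    (MeasurableEquiv.toLp 2 (Fin d → ℝ)).symm.measurableEmbedding fun y => ∏ i, f i (y i)

theorem integrable_prod_coord {f : Fin d → ℝ → ℝ} (hf : ∀ i, Integrable (f i)) :
    Integrable fun y : EuclideanSpace ℝ (Fin d) => ∏ i, f i (y i) :=
  ((PiLp.volume_preserving_ofLp (Fin d)).integrable_comp_emb
    (MeasurableEquiv.toLp 2 (Fin d → ℝ)).symm.measurableEmbedding).2
      (Integrable.fintype_prod (f := f) hf)

variable [NeZero d]

instance : Nontrivial (EuclideanSpace ℝ (Fin d)) :=
  Module.nontrivial_of_finrank_pos (R := ℝ) (by simpa using NeZero.pos d)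

/-- The function |y_0|^q e^(-|y|²) is a product of integrable one-variable functions. By Fubini in
polar coordinates it is integrable over almost every sphere, and homogeneity transfers this from one
such sphere to the unit sphere. -/
theorem integrable_sphere_abs_coord_rpow {q : ℝ} (hq : -1 < q) :
    Integrable (fun ω : sphere (0 : EuclideanSpace ℝ (Fin d)) 1 =>
      |(ω : EuclideanSpace ℝ (Fin d)) 0| ^ q)
      (volume : Measure (EuclideanSpace ℝ (Fin d))).toSphere := by
  have h1 : Integrable fun y : EuclideanSpace ℝ (Fin d) => |y 0| ^ q * Real.exp (-‖y‖ ^ 2) := by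
    have := integrable_prod_coord (d := d)
      (f := fun i t => |t| ^ (if i = 0 then q else 0) * Real.exp (-t ^ 2))
      fun i => integrable_abs_rpow_mul_exp (by split_ifs <;> linarith)
    refine this.congr (.of_forall fun y => ?_)
    simp only [Finset.prod_mul_distrib, ← exp_neg_norm_sq]
    congr 1
    rw [← Finset.mul_prod_erase _ _ (Finset.mem_univ (0 : Fin d)), if_pos rfl,
      Finset.prod_eq_one, mul_one]
    intro i hi
    rw [if_neg (Finset.ne_of_mem_erase hi), Real.rpow_zero]
  have h2 := ((integrable_sphere_prod_iff volume).2 h1).prod_left_ae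
  -- The radial measure must be nonzero for an almost-everywhere statement to supply an actual
  -- radius.
  have : NeZero (Measure.volumeIoiPow
      (Module.finrank ℝ (EuclideanSpace ℝ (Fin d)) - 1)) := by
    refine ⟨fun h => ?_⟩
    have := Measure.volumeIoiPow_apply_Iio
      (Module.finrank ℝ (EuclideanSpace ℝ (Fin d)) - 1) ⟨1, mem_Ioi.2 one_pos⟩
    rw [h] at this
    simp only [Measure.coe_zero, Pi.zero_apply, one_pow] at this
    exact (ENNReal.ofReal_pos.2 (by positivity)).ne this
  obtain ⟨t, ht⟩ := h2.exists
  have ht0 : (0 : ℝ) < t := t.2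
  have hc : (t : ℝ) ^ q * Real.exp (-(t : ℝ) ^ 2) ≠ 0 := by positivity
  refine (ht.const_mul ((t : ℝ) ^ q * Real.exp (-(t : ℝ) ^ 2))⁻¹).congr (.of_forall fun ω => ?_)
  simp only [PiLp.smul_apply, smul_eq_mul, abs_mul, abs_of_pos ht0, norm_smul, norm_eq_of_mem_sphere,
    mul_one, Real.norm_eq_abs]
  rw [Real.mul_rpow ht0.le (abs_nonneg _)]
  field_simp

/-- The Gaussian integral of a positively homogeneous function. -/
theorem integral_mul_exp_of_homogeneous {q : ℝ} {g : EuclideanSpace ℝ (Fin d) → ℝ}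
    (hg : ∀ t : ℝ, 0 < t → ∀ y, g (t • y) = t ^ q * g y) :
    ∫ y, g y * Real.exp (-‖y‖ ^ 2) =
      (∫ ω : sphere (0 : EuclideanSpace ℝ (Fin d)) 1, g ω
        ∂(volume : Measure (EuclideanSpace ℝ (Fin d))).toSphere) *
      ∫ t in Ioi (0 : ℝ), t ^ (d - 1) * (t ^ q * Real.exp (-t ^ 2)) := by
  rw [← integral_volumeIoiPow (d - 1) fun t => t ^ q * Real.exp (-t ^ 2), ← integral_prod_mul,
    integral_eq_integral_sphere_prod, finrank_euclideanSpace_fin]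
  refine integral_congr_ae (.of_forall fun x => ?_)
  have ht0 : (0 : ℝ) < x.2 := x.2.2
  simp only [hg _ ht0, norm_smul, norm_eq_of_mem_sphere, mul_one, Real.norm_eq_abs, sq_abs]
  ring

omit [NeZero d] in
theorem integral_Ioi_pow_mul_rpow_mul_exp_pos {q : ℝ} (hq : 0 < q) :
    0 < ∫ t in Ioi (0 : ℝ), t ^ (d - 1) * (t ^ q * Real.exp (-t ^ 2)) := by
  have h : ∀ t ∈ Ioi (0 : ℝ), t ^ (d - 1) * (t ^ q * Real.exp (-t ^ 2)) =
      t ^ (((d - 1 : ℕ) : ℝ) + q) * Real.exp (-1 * t ^ (2 : ℝ)) := by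
    intro t ht
    rw [Real.rpow_add ht]
    simp [mul_assoc]
  have hd : (0 : ℝ) ≤ ((d - 1 : ℕ) : ℝ) := Nat.cast_nonneg _
  rw [setIntegral_congr_fun measurableSet_Ioi h,
    integral_rpow_mul_exp_neg_mul_rpow two_pos (by linarith) one_pos]
  have := Real.Gamma_pos_of_pos (s := (((d - 1 : ℕ) : ℝ) + q + 1) / 2) (by linarith)
  simp only [Real.one_rpow]
  positivity

end Gaussian

/-! ### Second moments of the weighted sphere. -/

section Moments

variable {d : ℕ} [NeZero d]

/-- The moments `∫ |ω₀|^(p-2) ωᵢ ωⱼ dσ` on the unit sphere. -/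
def sphereMoment (d : ℕ) [NeZero d] (p : ℝ) (i j : Fin d) : ℝ :=
  ∫ ω : sphere (0 : EuclideanSpace ℝ (Fin d)) 1,
    |(ω : EuclideanSpace ℝ (Fin d)) 0| ^ (p - 2) *
      ((ω : EuclideanSpace ℝ (Fin d)) i * (ω : EuclideanSpace ℝ (Fin d)) j)
    ∂(volume : Measure (EuclideanSpace ℝ (Fin d))).toSphere

/-- The integrand is homogeneous of degree p, so its Gaussian integral splits in two ways: into an
angular and a radial factor, and into a product over coordinates. -/
theorem sphereMoment_mul (p : ℝ) (i j : Fin d) :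
    sphereMoment d p i j * ∫ t in Ioi (0 : ℝ), t ^ (d - 1) * (t ^ p * Real.exp (-t ^ 2)) =
      ∏ k : Fin d, ∫ t : ℝ, (if k = 0 then |t| ^ (p - 2) else 1) *
        ((if k = i then t else 1) * (if k = j then t else 1)) * Real.exp (-t ^ 2) := by
  rw [sphereMoment, ← integral_mul_exp_of_homogeneous
    (g := fun y : EuclideanSpace ℝ (Fin d) => |y 0| ^ (p - 2) * (y i * y j)), ← integral_prod_coord]
  · refine integral_congr_ae (.of_forall fun y => ?_)
    simp only [Finset.prod_mul_distrib, ← exp_neg_norm_sq]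
    simp
  · intro t ht y
    simp only [PiLp.smul_apply, smul_eq_mul, abs_mul, abs_of_pos ht]
    rw [Real.mul_rpow ht.le (abs_nonneg _), show p = (p - 2) + (2 : ℕ) by push_cast; ring,
      Real.rpow_add_natCast ht.ne']
    simp only [Nat.cast_ofNat, add_sub_cancel_right]
    ring

/-- One of the indices, say j, is not 0; its coordinate factor is the integral of the odd function t
e^(-t²). -/
theorem sphereMoment_of_ne {p : ℝ} (hp : 0 < p) {i j : Fin d} (hij : i ≠ j) :
    sphereMoment d p i j = 0 := by
  wlog hj : j ≠ 0 generalizing i j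
  · have hi : i ≠ 0 := by rintro rfl; exact hij (not_not.1 hj).symm
    rw [← this hij.symm hi]
    simp only [sphereMoment, mul_comm]
  have h := sphereMoment_mul (d := d) p i j
  rw [Finset.prod_eq_zero (Finset.mem_univ j)] at h
  · exact (mul_eq_zero.1 h).resolve_right (integral_Ioi_pow_mul_rpow_mul_exp_pos hp).ne'
  · simp [hj, hij.symm, integral_mul_exp_neg_sq]

/-- The two coordinate products differ only in the factors 0 and j. There Γ(x+1) = xΓ(x), at x =
(p-1)/2 and x = 1/2, produces the ratio p-1. -/
theorem sphereMoment_self {p : ℝ} (hp : 1 < p) {j : Fin d} (hj : j ≠ 0) :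
    (p - 1) * sphereMoment d p j j = sphereMoment d p 0 0 := by
  have hK := integral_Ioi_pow_mul_rpow_mul_exp_pos (d := d) (q := p) (by linarith)
  refine mul_right_cancel₀ hK.ne' ?_
  rw [mul_assoc, sphereMoment_mul, sphereMoment_mul]
  have h0 : (0 : Fin d) ∈ Finset.univ.erase j := by simp [hj.symm]
  rw [← Finset.mul_prod_erase _ _ (Finset.mem_univ j),
    ← Finset.mul_prod_erase Finset.univ _ (Finset.mem_univ j), ← Finset.mul_prod_erase _ _ h0,
    ← Finset.mul_prod_erase (Finset.univ.erase j) _ h0]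
  have hr : ∀ k ∈ (Finset.univ.erase j).erase 0, k ≠ 0 ∧ k ≠ j := by
    intro k hk
    simp only [Finset.mem_erase] at hk
    exact ⟨hk.1, hk.2.1⟩
  have hrest : ∀ i : Fin d, i = 0 ∨ i = j →
      ∏ k ∈ (Finset.univ.erase j).erase 0, (∫ t : ℝ, (if k = 0 then |t| ^ (p - 2) else 1) *
        ((if k = i then t else 1) * (if k = i then t else 1)) * Real.exp (-t ^ 2)) =
      ∏ _k ∈ (Finset.univ.erase j).erase 0, ∫ t : ℝ, Real.exp (-t ^ 2) := by
    intro i hi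
    refine Finset.prod_congr rfl fun k hk => ?_
    have hki : k ≠ i := by
      rcases hi with rfl | rfl
      exacts [(hr k hk).1, (hr k hk).2]
    simp [(hr k hk).1, hki]
  rw [hrest j (.inr rfl), hrest 0 (.inl rfl)]
  have e0 : ∫ t : ℝ, Real.exp (-t ^ 2) = Real.Gamma (1 / 2) := by
    simpa using integral_abs_rpow_mul_exp (q := 0) (by norm_num)
  have e2 : ∫ t : ℝ, t * t * Real.exp (-t ^ 2) = Real.Gamma (1 / 2) / 2 := by
    have := integral_abs_rpow_mul_exp (q := 2) (by norm_num)
    rw [show ((2 : ℝ) + 1) / 2 = 1 / 2 + 1 by norm_num, Real.Gamma_add_one (by norm_num)] at this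
    rw [mul_comm, ← div_eq_mul_one_div] at this
    rw [← this]
    simp [sq]
  have ep : ∫ t : ℝ, |t| ^ (p - 2) * (t * t) * Real.exp (-t ^ 2) =
      (p - 1) / 2 * Real.Gamma ((p - 1) / 2) := by
    have := integral_abs_rpow_mul_exp (q := p) (by linarith)
    rw [show (p + 1) / 2 = (p - 1) / 2 + 1 by ring, Real.Gamma_add_one (by linarith)] at this
    rw [← this]
    refine integral_congr_ae ?_
    have : ∀ᵐ t : ℝ, t ≠ 0 := by simp [ae_iff]
    filter_upwards [this] with t ht
    congr 1
    conv_rhs => rw [show p = (p - 2) + (2 : ℕ) by push_cast; ring,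
      Real.rpow_add_natCast (abs_pos.2 ht).ne', sq_abs]
    ring
  have eq : ∫ t : ℝ, |t| ^ (p - 2) * Real.exp (-t ^ 2) = Real.Gamma ((p - 1) / 2) := by
    rw [integral_abs_rpow_mul_exp (by linarith)]
    ring_nf
  simp only [hj, hj.symm, if_true, if_false, one_mul, mul_one, e0, e2, ep, eq]
  ring

theorem sphereMoment_zero (p : ℝ) :
    sphereMoment d p 0 0 = ∫ ω : sphere (0 : EuclideanSpace ℝ (Fin d)) 1,
      |(ω : EuclideanSpace ℝ (Fin d)) 0| ^ p
        ∂(volume : Measure (EuclideanSpace ℝ (Fin d))).toSphere := by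
  refine integral_congr_ae ?_
  filter_upwards [ae_toSphere_coord_ne_zero] with ω hω
  conv_rhs => rw [show p = (p - 2) + (2 : ℕ) by push_cast; ring,
    Real.rpow_add_natCast (abs_pos.2 hω).ne', sq_abs]
  ring

theorem integrable_sphereMoment {p : ℝ} (hp : 1 < p) (i j : Fin d) :
    Integrable (fun ω : sphere (0 : EuclideanSpace ℝ (Fin d)) 1 =>
      |(ω : EuclideanSpace ℝ (Fin d)) 0| ^ (p - 2) *
      ((ω : EuclideanSpace ℝ (Fin d)) i * (ω : EuclideanSpace ℝ (Fin d)) j))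
      (volume : Measure (EuclideanSpace ℝ (Fin d))).toSphere := by
  refine (integrable_sphere_abs_coord_rpow (by linarith)).mul_bdd (c := 1) ?_ ?_
  · refine Continuous.aestronglyMeasurable ?_
    fun_prop
  · refine .of_forall fun ω => ?_
    have h : ∀ k, ‖(ω : EuclideanSpace ℝ (Fin d)) k‖ ≤ 1 := fun k => by
      simpa using PiLp.norm_apply_le (ω : EuclideanSpace ℝ (Fin d)) k
    rw [norm_mul]
    exact mul_le_one₀ (h i) (norm_nonneg _) (h j)

theorem sphereMoment_zero_pos {p : ℝ} (hp : 1 < p) : 0 < sphereMoment d p 0 0 := by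
  rw [sphereMoment_zero p, integral_pos_iff_support_of_nonneg]
  · have : (Function.support fun ω : sphere (0 : EuclideanSpace ℝ (Fin d)) 1 =>
        |(ω : EuclideanSpace ℝ (Fin d)) 0| ^ p) =ᵐ[(volume : Measure _).toSphere] univ := by
      rw [eventuallyEq_univ]
      filter_upwards [ae_toSphere_coord_ne_zero] with ω hω
      simp only [Function.mem_support]
      have := abs_pos.2 hω
      positivity
    rw [measure_congr this]
    exact Measure.measure_univ_pos.2 (Measure.toSphere_ne_zero _)
  · intro ω
    positivity
  · exact integrable_sphere_abs_coord_rpow (by linarith)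

end Moments

/-! ### The leading term and the p-Laplacian. -/

section MainTerm

variable {d : ℕ} [NeZero d]

/-- In an orthonormal basis b with v = |v| b_0 only the diagonal entries H_ii survive, with weight
p-1 for i = 0 and 1 otherwise, up to a common factor. That sum is tr H + (p-2) H_00. -/
theorem sphere_integral_main {p : ℝ} (hp : 1 < p) {v : EuclideanSpace ℝ (Fin d)} (hv : v ≠ 0)
    (H : EuclideanSpace ℝ (Fin d) →L[ℝ] EuclideanSpace ℝ (Fin d)) :
    (p - 1) * ∫ ω : sphere (0 : EuclideanSpace ℝ (Fin d)) 1,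
      |inner ℝ v (ω : EuclideanSpace ℝ (Fin d))| ^ (p - 2) * inner ℝ (H ω) (ω : EuclideanSpace ℝ (Fin d))
        ∂(volume : Measure (EuclideanSpace ℝ (Fin d))).toSphere =
      sphereMoment d p 0 0 * (‖v‖ ^ (p - 2) * ∑ i, H (EuclideanSpace.single i 1) i +
        (p - 2) * ‖v‖ ^ (p - 4) * inner ℝ v (H v)) := by
  obtain ⟨b, hb⟩ := exists_orthonormalBasis_zero hv
  have hv0 : 0 < ‖v‖ := norm_pos_iff.2 hv
  have hvb : v = ‖v‖ • b 0 := by simp [hb, smul_smul, hv]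
  have htr : ∑ i, H (EuclideanSpace.single i 1) i = ∑ i, inner ℝ (b i) (H (b i)) := by
    have h1 := LinearMap.trace_eq_sum_inner (H : EuclideanSpace ℝ (Fin d) →ₗ[ℝ] _) b
    have h2 := LinearMap.trace_eq_sum_inner (H : EuclideanSpace ℝ (Fin d) →ₗ[ℝ] _)
      (EuclideanSpace.basisFun (Fin d) ℝ)
    rw [h1] at h2
    simp only [ContinuousLinearMap.coe_coe] at h2
    rw [h2]
    refine Finset.sum_congr rfl fun i _ => ?_
    rw [EuclideanSpace.basisFun_apply, EuclideanSpace.inner_single_left]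
    simp
  have hin : inner ℝ v (H v) = ‖v‖ ^ 2 * inner ℝ (b 0) (H (b 0)) := by
    conv_lhs => rw [hvb]
    rw [map_smul, real_inner_smul_left, real_inner_smul_right]
    ring
  have hint : ∀ ω : sphere (0 : EuclideanSpace ℝ (Fin d)) 1,
      |inner ℝ v (b.repr.symm ω)| ^ (p - 2) * inner ℝ (H (b.repr.symm ω)) (b.repr.symm ω) =
      ∑ i, ∑ j, ‖v‖ ^ (p - 2) * inner ℝ (H (b i)) (b j) *
        (|(ω : EuclideanSpace ℝ (Fin d)) 0| ^ (p - 2) *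
      ((ω : EuclideanSpace ℝ (Fin d)) i * (ω : EuclideanSpace ℝ (Fin d)) j)) := by
    intro ω
    have h1 : inner ℝ v (b.repr.symm ω) = ‖v‖ * (ω : EuclideanSpace ℝ (Fin d)) 0 := by
      conv_lhs => rw [hvb]
      rw [real_inner_smul_left, ← OrthonormalBasis.repr_apply_apply,
        LinearIsometryEquiv.apply_symm_apply]
    rw [h1, abs_mul, abs_of_pos hv0, Real.mul_rpow hv0.le (abs_nonneg _)]
    have h2 : b.repr.symm ω = ∑ i, (ω : EuclideanSpace ℝ (Fin d)) i • b i := by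
      rw [b.sum_repr_symm]
    rw [h2, map_sum, sum_inner, Finset.mul_sum]
    refine Finset.sum_congr rfl fun i _ => ?_
    rw [inner_sum, Finset.mul_sum]
    refine Finset.sum_congr rfl fun j _ => ?_
    rw [map_smul, real_inner_smul_left, real_inner_smul_right]
    ring
  rw [← integral_sphere_comp b.repr.symm fun ω => |inner ℝ v ω| ^ (p - 2) * inner ℝ (H ω) ω]
  simp_rw [hint]
  rw [integral_finsetSum _ fun i _ => integrable_finsetSum _ fun j _ =>
    (integrable_sphereMoment hp i j).const_mul _]
  simp_rw [integral_finsetSum _ fun j _ => (integrable_sphereMoment hp _ j).const_mul _,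
    integral_const_mul]
  change (p - 1) * ∑ i, ∑ j, ‖v‖ ^ (p - 2) * inner ℝ (H (b i)) (b j) * sphereMoment d p i j = _
  have hdiag : ∀ i, ∑ j, ‖v‖ ^ (p - 2) * inner ℝ (H (b i)) (b j) * sphereMoment d p i j =
      ‖v‖ ^ (p - 2) * inner ℝ (b i) (H (b i)) * sphereMoment d p i i := by
    intro i
    rw [Finset.sum_eq_single i, real_inner_comm]
    · intro j _ hj
      rw [sphereMoment_of_ne (by linarith) hj.symm, mul_zero]
    · simp
  simp_rw [hdiag]
  rw [Finset.mul_sum, htr, hin, ← Finset.add_sum_erase _ _ (Finset.mem_univ (0 : Fin d)),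
    ← Finset.add_sum_erase _ (fun i => inner ℝ (b i) (H (b i))) (Finset.mem_univ (0 : Fin d)),
    Finset.sum_congr rfl (g := fun i => sphereMoment d p 0 0 * ‖v‖ ^ (p - 2) *
      inner ℝ (b i) (H (b i))), ← Finset.mul_sum]
  · have : ‖v‖ ^ (p - 2) = ‖v‖ ^ (p - 4) * ‖v‖ ^ 2 := by
      rw [← Real.rpow_natCast, ← Real.rpow_add hv0]; norm_num; ring_nf
    rw [this]
    ring
  · intro i hi
    rw [← sphereMoment_self hp (Finset.ne_of_mem_erase hi)]
    ring

omit [NeZero d] in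
theorem pLaplacian_eq {p : ℝ} {φ : EuclideanSpace ℝ (Fin d) → ℝ} {z : EuclideanSpace ℝ (Fin d)}
    {H : EuclideanSpace ℝ (Fin d) →L[ℝ] EuclideanSpace ℝ (Fin d)}
    (hH : HasFDerivAt (gradient φ) H z) (hv : gradient φ z ≠ 0) :
    pLaplacian p φ z = ‖gradient φ z‖ ^ (p - 2) * ∑ i, H (EuclideanSpace.single i 1) i +
        (p - 2) * ‖gradient φ z‖ ^ (p - 4) * inner ℝ (gradient φ z) (H (gradient φ z)) := by
  set v := gradient φ z with hvdef
  have hv0 : 0 < ‖v‖ := norm_pos_iff.2 hv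
  have h1 := (hH.norm_sq.rpow_const (p := (p - 2) / 2)
    (Or.inl (by rw [← hvdef]; positivity))).smul hH
  -- The power is rewritten through the squared norm, to which the chain and product rules apply
  -- directly.
  have h2 : (fun w => ‖gradient φ w‖ ^ (p - 2) • gradient φ w) =
      fun w => (‖gradient φ w‖ ^ 2) ^ ((p - 2) / 2) • gradient φ w := by
    ext1 w
    rw [← Real.rpow_natCast_mul (norm_nonneg _)]
    congr 2
    push_cast
    ring
  have e1 : (‖v‖ ^ 2) ^ ((p - 2) / 2) = ‖v‖ ^ (p - 2) := by
    rw [← Real.rpow_natCast_mul (norm_nonneg _)]; congr 1; push_cast; ring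
  have e2 : (‖v‖ ^ 2) ^ ((p - 2) / 2 - 1) = ‖v‖ ^ (p - 4) := by
    rw [← Real.rpow_natCast_mul (norm_nonneg _)]; congr 1; push_cast; ring
  have hsum : inner ℝ v (H v) = ∑ i, v i * inner ℝ v (H (EuclideanSpace.single i 1)) := by
    have hv' : v = ∑ i, v i • EuclideanSpace.single i (1 : ℝ) := by
      conv_lhs => rw [← (EuclideanSpace.basisFun (Fin d) ℝ).sum_repr v]
      simp
    conv_lhs => rw [hv', map_sum, ← hv', inner_sum]
    simp only [map_smul, real_inner_smul_right]
  have h3 := h1.fderiv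
  rw [Pi.smul_def'] at h3
  rw [pLaplacian, divergence, h2, h3, ← hvdef, e1, e2, hsum, Finset.mul_sum, Finset.mul_sum,
    ← Finset.sum_add_distrib]
  refine Finset.sum_congr rfl fun i _ => ?_
  simp
  ring

end MainTerm

/-! ### Symmetric Taylor estimates in one variable. -/

section OneDim

/-- The mean value inequality on [0, t]; the factor 1/(k+1) of exact integration is given up to keep
the constant the same at every iteration. -/
theorem abs_le_pow_succ_of_deriv {e e' : ℝ → ℝ} {a C : ℝ} {k : ℕ} (h0 : e 0 = 0)
    (hd : ∀ t ∈ Icc 0 a, HasDerivAt e (e' t) t) (hb : ∀ t ∈ Icc 0 a, |e' t| ≤ C * t ^ k) :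
    ∀ t ∈ Icc 0 a, |e t| ≤ C * t ^ (k + 1) := by
  intro t ht
  rcases ht.1.eq_or_lt with rfl | htpos
  · simp [h0]
  have hC : 0 ≤ C := by
    have h1 := (abs_nonneg _).trans (hb t ht)
    exact nonneg_of_mul_nonneg_left h1 (by positivity)
  have hsub : Icc 0 t ⊆ Icc 0 a := Icc_subset_Icc_right ht.2
  have := (convex_Icc (0 : ℝ) t).norm_image_sub_le_of_norm_hasDerivWithin_le (f := e) (f' := e')
    (C := C * t ^ k) (fun x hx => (hd x (hsub hx)).hasDerivWithinAt)
    (fun x hx => (hb x (hsub hx)).trans (by have := hx.1; have := hx.2; gcongr))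
    (left_mem_Icc.2 ht.1) (right_mem_Icc.2 ht.1)
  rw [h0, sub_zero, sub_zero, Real.norm_eq_abs, Real.norm_eq_abs, abs_of_pos htpos] at this
  rwa [pow_succ, ← mul_assoc]

variable {h₀ h₁ h₂ h₃ h₄ : ℝ → ℝ} {a M : ℝ}

/-- Oddness removes the second-order term. The bound on h₃ is integrated three times, alternating
between odd and even parts. -/
theorem odd_taylor (d₀ : ∀ t ∈ Icc (-a) a, HasDerivAt h₀ (h₁ t) t)
    (d₁ : ∀ t ∈ Icc (-a) a, HasDerivAt h₁ (h₂ t) t)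
    (d₂ : ∀ t ∈ Icc (-a) a, HasDerivAt h₂ (h₃ t) t) (hM : ∀ t ∈ Icc (-a) a, |h₃ t| ≤ M) :
    ∀ t ∈ Icc 0 a, |h₀ t - h₀ (-t) - 2 * t * h₁ 0| ≤ 2 * M * t ^ 3 := by
  have mp : ∀ t ∈ Icc 0 a, t ∈ Icc (-a) a := fun t ht => ⟨by linarith [ht.1, ht.2], ht.2⟩
  have mn : ∀ t ∈ Icc 0 a, -t ∈ Icc (-a) a := fun t ht =>
    ⟨by linarith [ht.1, ht.2], by linarith [ht.1, ht.2]⟩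
  have neg : ∀ {h h' : ℝ → ℝ}, (∀ t ∈ Icc (-a) a, HasDerivAt h (h' t) t) →
      ∀ t ∈ Icc 0 a, HasDerivAt (fun t => h (-t)) (-h' (-t)) t := fun H t ht =>
    ((H (-t) (mn t ht)).comp t (hasDerivAt_neg t)).congr_deriv (by ring)
  have s2 : ∀ t ∈ Icc 0 a, |h₂ t - h₂ (-t)| ≤ 2 * M * t ^ 1 := by
    refine abs_le_pow_succ_of_deriv (k := 0) (e' := fun t => h₃ t - -h₃ (-t)) (by simp)
      (fun t ht => (d₂ t (mp t ht)).sub (neg d₂ t ht)) fun t ht => ?_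
    rw [sub_neg_eq_add, pow_zero, mul_one, two_mul]
    exact (abs_add_le _ _).trans (add_le_add (hM t (mp t ht)) (hM _ (mn t ht)))
  have s1 : ∀ t ∈ Icc 0 a, |h₁ t + h₁ (-t) - 2 * h₁ 0| ≤ 2 * M * t ^ 2 :=
    abs_le_pow_succ_of_deriv (e' := fun t => h₂ t - h₂ (-t)) (by simp; ring)
      (fun t ht => ((d₁ t (mp t ht)).add (neg d₁ t ht)).sub_const _) s2
  refine abs_le_pow_succ_of_deriv (e' := fun t => h₁ t + h₁ (-t) - 2 * h₁ 0) (by simp)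
    (fun t ht => ?_) s1
  exact (((d₀ t (mp t ht)).sub (neg d₀ t ht)).sub
    (((hasDerivAt_id t).const_mul 2).mul_const (h₁ 0))).congr_deriv (by ring)

theorem even_taylor (d₀ : ∀ t ∈ Icc (-a) a, HasDerivAt h₀ (h₁ t) t)
    (d₁ : ∀ t ∈ Icc (-a) a, HasDerivAt h₁ (h₂ t) t)
    (d₂ : ∀ t ∈ Icc (-a) a, HasDerivAt h₂ (h₃ t) t)
    (d₃ : ∀ t ∈ Icc (-a) a, HasDerivAt h₃ (h₄ t) t) (hM : ∀ t ∈ Icc (-a) a, |h₄ t| ≤ M) :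
    ∀ t ∈ Icc 0 a, |h₀ t + h₀ (-t) - 2 * h₀ 0 - t ^ 2 * h₂ 0| ≤ 2 * M * t ^ 4 := by
  refine abs_le_pow_succ_of_deriv (by simp; ring) (fun t ht => ?_) (odd_taylor d₁ d₂ d₃ hM)
  have mp : t ∈ Icc (-a) a := ⟨by linarith [ht.1, ht.2], ht.2⟩
  have mn : -t ∈ Icc (-a) a := ⟨by linarith [ht.1, ht.2], by linarith [ht.1, ht.2]⟩
  exact ((((d₀ t mp).add ((d₀ (-t) mn).comp t (hasDerivAt_neg t))).sub_const (2 * h₀ 0)).sub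
    (((hasDerivAt_id t).pow 2).mul_const (h₂ 0))).congr_deriv (by simp; ring)

end OneDim

/-! ### Pointwise expansion of the symmetrised nonlinearity. -/

section Pointwise

theorem J_neg (p ξ : ℝ) : J p (-ξ) = -J p ξ := by simp [J]

theorem abs_J {p : ℝ} (hp : 1 < p) (ξ : ℝ) : |J p ξ| = |ξ| ^ (p - 1) := by
  rcases eq_or_ne ξ 0 with rfl | h
  · simp [J, Real.zero_rpow (sub_ne_zero.2 hp.ne')]
  · rw [J, abs_mul, abs_of_nonneg (by positivity), ← Real.rpow_add_one (abs_pos.2 h).ne']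
    ring_nf

theorem J_of_pos (p : ℝ) {ξ : ℝ} (hξ : 0 < ξ) : J p ξ = ξ ^ (p - 1) := by
  rw [J, abs_of_pos hξ, ← Real.rpow_add_one hξ.ne']
  ring_nf

theorem J_mul (p : ℝ) {r : ℝ} (hr : 0 < r) (ξ : ℝ) : J p (r * ξ) = r ^ (p - 1) * J p ξ := by
  rw [J, J, abs_mul, abs_of_pos hr, Real.mul_rpow hr.le (abs_nonneg _),
    show p - 1 = p - 2 + 1 by ring, Real.rpow_add_one hr.ne']
  ring

theorem continuous_J {p : ℝ} (hp : 1 < p) : Continuous (J p) := by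
  rw [continuous_iff_continuousAt]
  intro ξ
  rcases eq_or_ne ξ 0 with rfl | h
  · have h0 : J p 0 = 0 := by simp [J]
    rw [ContinuousAt, h0, tendsto_zero_iff_abs_tendsto_zero]
    have : (abs ∘ J p) = fun ξ => |ξ| ^ (p - 1) := funext fun ξ => abs_J hp ξ
    rw [this]
    have hc : Continuous fun ξ : ℝ => |ξ| ^ (p - 1) :=
      continuous_abs.rpow_const fun _ => Or.inr (by linarith)
    simpa [Real.zero_rpow (sub_ne_zero.2 hp.ne')] using hc.tendsto 0
  · exact (continuousAt_id.abs.rpow_const (Or.inl (abs_pos.2 h).ne')).mul continuousAt_id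

theorem rpow_le_of_mem {x u : ℝ} (hu : 0 < u) (h1 : u / 2 ≤ x) (h2 : x ≤ 2 * u) (s : ℝ) :
    x ^ s ≤ 2 ^ |s| * u ^ s := by
  have hx : 0 < x := by linarith
  rcases le_total 0 s with hs | hs
  · rw [abs_of_nonneg hs, ← Real.mul_rpow two_pos.le hu.le]
    exact Real.rpow_le_rpow hx.le h2 hs
  · rw [abs_of_nonpos hs]
    calc x ^ s ≤ (u / 2) ^ s := Real.rpow_le_rpow_of_nonpos (by linarith) h1 hs
      _ = 2 ^ (-s) * u ^ s := by
        rw [Real.div_rpow hu.le two_pos.le, Real.rpow_neg two_pos.le]; ring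

/-- This is `odd_taylor` for t ↦ (m+t)^q on |t| ≤ u/4, where m + t stays comparable to u and the
third derivative has size u^(q-3). -/
theorem abs_rpow_add_sub_rpow_sub_le {u m δ : ℝ} (hu : 0 < u) (hm : |m - u| ≤ u / 4)
    (hδ : |δ| ≤ u / 4) (q : ℝ) :
    |(m + δ) ^ q - (m - δ) ^ q - 2 * δ * (q * m ^ (q - 1))| ≤
      2 * (|q * (q - 1) * (q - 2)| * (2 ^ |q - 3| * u ^ (q - 3))) * |δ| ^ 3 := by
  wlog h : 0 ≤ δ generalizing δ
  · have := this (δ := -δ) (by rwa [abs_neg]) (by linarith)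
    rw [abs_neg, ← abs_neg] at this
    refine le_of_eq_of_le ?_ this
    congr 1
    rw [sub_neg_eq_add, ← sub_eq_add_neg]
    ring
  rw [abs_of_nonneg h] at hδ ⊢
  have hm' := abs_le.1 hm
  have hpos : ∀ t ∈ Icc (-(u / 4)) (u / 4), u / 2 ≤ m + t ∧ m + t ≤ 2 * u := fun t ht =>
    ⟨by linarith [ht.1], by linarith [ht.2]⟩
  have hD : ∀ s : ℝ, ∀ t ∈ Icc (-(u / 4)) (u / 4),
      HasDerivAt (fun t => (m + t) ^ s) (s * (m + t) ^ (s - 1)) t := fun s t ht => by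
    have := ((hasDerivAt_id t).const_add m).rpow_const (p := s)
      (Or.inl (by have := (hpos t ht).1; simp only [id]; linarith))
    simpa using this
  have := odd_taylor (a := u / 4) (h₀ := fun t => (m + t) ^ q)
    (h₁ := fun t => q * (m + t) ^ (q - 1)) (h₂ := fun t => q * ((q - 1) * (m + t) ^ (q - 2)))
    (h₃ := fun t => q * ((q - 1) * ((q - 2) * (m + t) ^ (q - 3))))
    (M := |q * (q - 1) * (q - 2)| * (2 ^ |q - 3| * u ^ (q - 3))) (hD q)
    (fun t ht => by
      have := (hD (q - 1) t ht).const_mul q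
      rwa [show q - 1 - 1 = q - 2 by ring] at this)
    (fun t ht => by
      have := ((hD (q - 2) t ht).const_mul (q - 1)).const_mul q
      rwa [show q - 2 - 1 = q - 3 by ring] at this)
    (fun t ht => by
      have h := hpos t ht
      have h3 := rpow_le_of_mem hu h.1 h.2 (q - 3)
      rw [← mul_assoc, ← mul_assoc, abs_mul,
        abs_of_nonneg (Real.rpow_nonneg (by linarith : 0 ≤ m + t) _)]
      gcongr) δ ⟨h, hδ⟩
  simpa [← sub_eq_add_neg] using this

theorem abs_rpow_sub_rpow_le {u m : ℝ} (hu : 0 < u) (hm : |m - u| ≤ u / 4) (q : ℝ) :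
    |m ^ q - u ^ q| ≤ |q| * (2 ^ |q - 1| * u ^ (q - 1)) * |m - u| := by
  have hm' := abs_le.1 hm
  refine (convex_Icc (u - u / 4) (u + u / 4)).norm_image_sub_le_of_norm_hasDerivWithin_le
    (f := fun t => t ^ q) (f' := fun t => q * t ^ (q - 1)) (fun x hx => ?_) (fun x hx => ?_)
    ⟨by linarith, by linarith⟩ ⟨by linarith, by linarith⟩
  · exact (Real.hasDerivAt_rpow_const (Or.inl (by linarith [hx.1]))).hasDerivWithinAt
  · have h3 := rpow_le_of_mem (x := x) hu (by linarith [hx.1]) (by linarith [hx.2]) (q - 1)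
    rw [norm_mul, Real.norm_eq_abs, Real.norm_eq_abs,
      abs_of_nonneg (Real.rpow_nonneg (by linarith [hx.1] : 0 ≤ x) _)]
    gcongr

/-- The hypotheses on the mean `m` and the half-difference `δ` of the difference quotients of a
function in the directions `ω` and `-ω`, where `u` and `q` are its first and second derivative in
the direction `ω`. -/
structure DiffBounds (K r m δ u q : ℝ) : Prop where
  abs_u : |u| ≤ K
  mean : |m - u| ≤ K * r ^ 2
  diff : |2 * δ - r * q| ≤ K * r ^ 3
  abs_diff : |δ| ≤ K * r

theorem DiffBounds.neg {K r m δ u q : ℝ} (h : DiffBounds K r m δ u q) :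
    DiffBounds K r (-m) δ (-u) q where
  abs_u := by rw [abs_neg]; exact h.abs_u
  mean := by rw [← neg_sub', abs_neg, sub_eq_add_neg, ← sub_eq_add_neg]; exact h.mean
  diff := h.diff
  abs_diff := h.abs_diff

/-- The error of the second order expansion of `J p (m + δ) - J p (m - δ)`. -/
def expansionError (p r m δ u q : ℝ) : ℝ :=
  J p (m + δ) - J p (m - δ) - (p - 1) * |u| ^ (p - 2) * (r * q)

/-- The symmetry ω ↦ -ω, which allows u > 0 to be assumed. -/
theorem expansionError_neg (p r m δ u q : ℝ) :
    expansionError p r (-m) δ (-u) q = expansionError p r m δ u q := by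
  have h1 : -m + δ = -(m - δ) := by ring
  have h2 : -m - δ = -(m + δ) := by ring
  rw [expansionError, expansionError, h1, h2, J_neg, J_neg, abs_neg]
  ring

variable {K r m δ u q : ℝ}

theorem DiffBounds.abs_mul_le (h : DiffBounds K r m δ u q) (hK : 1 ≤ K) (hr : 0 < r)
    (hr1 : r ≤ 1) : |r * q| ≤ 3 * K * r := by
  have h1 := abs_le.1 h.diff
  have h2 := abs_le.1 h.abs_diff
  have h3 : K * r ^ 3 ≤ K * r := by
    gcongr
    exact pow_le_of_le_one hr.le hr1 (by norm_num)
  rw [abs_le]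
  constructor <;> linarith

/-- No cancellation is used: |m ± δ| ≤ 4Kr + Kr² + Kr ≤ 6Kr, and the three terms are bounded
separately. -/
theorem abs_expansionError_le_of_small {p : ℝ} (hp : 1 < p) (hK : 1 ≤ K) (hr : 0 < r) (hr1 : r ≤ 1)
    (h : DiffBounds K r m δ u q) (hu : |u| ≤ 4 * K * r) :
    |expansionError p r m δ u q| ≤
      2 * (6 * K) ^ (p - 1) * r ^ (p - 1) + 3 * (p - 1) * K * (r * |u| ^ (p - 2)) := by
  have h1 := abs_le.1 h.mean
  have h2 := abs_le.1 h.abs_diff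
  have h3 : K * r ^ 2 ≤ K * r := by
    gcongr
    exact pow_le_of_le_one hr.le hr1 (by norm_num)
  have h4 := abs_le.1 hu
  have hJ : ∀ ξ, |ξ| ≤ 6 * K * r → |J p ξ| ≤ (6 * K) ^ (p - 1) * r ^ (p - 1) := fun ξ hξ => by
    rw [abs_J hp, ← Real.mul_rpow (by linarith) hr.le]
    exact Real.rpow_le_rpow (abs_nonneg _) hξ (by linarith)
  have ha := hJ (m + δ) (abs_le.2 ⟨by linarith, by linarith⟩)
  have hb := hJ (m - δ) (abs_le.2 ⟨by linarith, by linarith⟩)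
  have hc : |(p - 1) * |u| ^ (p - 2) * (r * q)| ≤ 3 * (p - 1) * K * (r * |u| ^ (p - 2)) := by
    have hp' : 0 ≤ (p - 1) * |u| ^ (p - 2) := mul_nonneg (by linarith) (by positivity)
    rw [abs_mul, abs_of_nonneg hp']
    calc _ ≤ (p - 1) * |u| ^ (p - 2) * (3 * K * r) := by
          gcongr; exact h.abs_mul_le hK hr hr1
      _ = _ := by ring
  rw [expansionError]
  calc _ ≤ |J p (m + δ)| + |J p (m - δ)| + |(p - 1) * |u| ^ (p - 2) * (r * q)| :=
        (abs_sub _ _).trans (add_le_add_left (abs_sub _ _) _)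
    _ ≤ _ := by linarith

/-- Now m and δ are within u/4 of u and 0, away from the singularity. Three errors arise: Taylor
expansion of t^(p-1) about m, replacing m^(p-2) by u^(p-2), and replacing 2δ by rq. They have sizes
r³u^(p-4), r³u^(p-3) and r³u^(p-2), and u ≤ K absorbs the last two into the first. -/
theorem exists_abs_expansionError_le_of_large {p : ℝ} (hp : 1 < p) (hK : 1 ≤ K) :
    ∃ C, 0 ≤ C ∧ ∀ r m δ u q, 0 < r → r ≤ 1 → DiffBounds K r m δ u q → 4 * K * r < |u| →
      |expansionError p r m δ u q| ≤ C * (r ^ 3 * |u| ^ (p - 4)) := by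
  refine ⟨2 * (|(p - 1) * (p - 1 - 1) * (p - 1 - 2)| * 2 ^ |p - 4|) * K ^ 3 +
    2 * (p - 1) * (|p - 2| * 2 ^ |p - 3|) * K ^ 3 + (p - 1) * K ^ 3,
    by have : 0 ≤ p - 1 := by linarith
       positivity, ?_⟩
  intro r m δ u q hr hr1 h hu
  wlog hpos : 0 < u generalizing m u
  · have hu0 : u ≠ 0 := by
      rintro rfl
      simp only [abs_zero] at hu
      have : 0 < 4 * K * r := by positivity
      linarith
    have := this (-m) (-u) h.neg (by rwa [abs_neg])
      (by rcases lt_or_gt_of_ne hu0 with h | h <;> [linarith; exact absurd h hpos])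
    rwa [expansionError_neg, abs_neg] at this
  have hau := h.abs_u
  rw [abs_of_pos hpos] at hu hau ⊢
  have h3 : K * r ^ 2 ≤ K * r := by
    gcongr
    exact pow_le_of_le_one hr.le hr1 (by norm_num)
  have hm4 : |m - u| ≤ u / 4 := by linarith [h.mean]
  have hδ4 : |δ| ≤ u / 4 := by linarith [h.abs_diff]
  have hm' := abs_le.1 hm4
  have hδ' := abs_le.1 hδ4
  have hp1 : 0 ≤ p - 1 := by linarith
  have e1 := abs_rpow_add_sub_rpow_sub_le hpos hm4 hδ4 (p - 1)
  have e2 := abs_rpow_sub_rpow_le hpos hm4 (p - 2)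
  rw [show p - 1 - 3 = p - 4 by ring] at e1
  rw [show p - 2 - 1 = p - 3 by ring] at e2
  have u3 : u ^ (p - 3) ≤ K * u ^ (p - 4) := by
    rw [show p - 3 = p - 4 + 1 by ring, Real.rpow_add_one hpos.ne', mul_comm]
    gcongr
  have u2 : u ^ (p - 2) ≤ K ^ 2 * u ^ (p - 4) := by
    rw [show p - 2 = p - 4 + (2 : ℕ) by push_cast; ring, Real.rpow_add_natCast hpos.ne', mul_comm]
    gcongr
  have b1 : |(m + δ) ^ (p - 1) - (m - δ) ^ (p - 1) - 2 * δ * ((p - 1) * m ^ (p - 1 - 1))| ≤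
      2 * (|(p - 1) * (p - 1 - 1) * (p - 1 - 2)| * 2 ^ |p - 4|) * K ^ 3 *
        (r ^ 3 * u ^ (p - 4)) := by
    calc _ ≤ _ := e1
      _ ≤ 2 * (|(p - 1) * (p - 1 - 1) * (p - 1 - 2)| * (2 ^ |p - 4| * u ^ (p - 4))) *
          (K * r) ^ 3 := by gcongr; exact h.abs_diff
      _ = _ := by ring
  have b2 : |2 * δ * (p - 1) * (m ^ (p - 2) - u ^ (p - 2))| ≤
      2 * (p - 1) * (|p - 2| * 2 ^ |p - 3|) * K ^ 3 * (r ^ 3 * u ^ (p - 4)) := by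
    rw [abs_mul, abs_mul, abs_mul, abs_two, abs_of_nonneg hp1]
    calc _ ≤ 2 * (K * r) * (p - 1) *
          (|p - 2| * (2 ^ |p - 3| * (K * u ^ (p - 4))) * (K * r ^ 2)) := by
          gcongr
          · exact h.abs_diff
          · refine e2.trans ?_
            gcongr
            exact h.mean
      _ = _ := by ring
  have b3 : |(p - 1) * u ^ (p - 2) * (2 * δ - r * q)| ≤
      (p - 1) * K ^ 3 * (r ^ 3 * u ^ (p - 4)) := by
    rw [abs_mul, abs_mul, abs_of_nonneg hp1, abs_of_nonneg (Real.rpow_nonneg hpos.le _)]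
    calc _ ≤ (p - 1) * (K ^ 2 * u ^ (p - 4)) * (K * r ^ 3) := by
          gcongr
          exact h.diff
      _ = _ := by ring
  rw [expansionError, J_of_pos p (by linarith), J_of_pos p (by linarith), abs_of_pos hpos]
  rw [show p - 1 - 1 = p - 2 by ring] at b1
  have key : (m + δ) ^ (p - 1) - (m - δ) ^ (p - 1) - (p - 1) * u ^ (p - 2) * (r * q) =
      ((m + δ) ^ (p - 1) - (m - δ) ^ (p - 1) - 2 * δ * ((p - 1) * m ^ (p - 2))) +
      2 * δ * (p - 1) * (m ^ (p - 2) - u ^ (p - 2)) + (p - 1) * u ^ (p - 2) * (2 * δ - r * q) := by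
    ring
  rw [key]
  refine (abs_add_three _ _ _).trans ?_
  rw [show p - 1 - 1 = p - 2 by ring, add_mul, add_mul]
  linarith

/-- Interpolation between the two regimes: for large u, r ≤ |u| trades r^(2-γ) for |u|^(2-γ), which
needs γ ≤ 2; for small u, |u|^γ ≤ (4Kr)^γ needs γ ≥ 0. -/
theorem exists_abs_expansionError_le {p γ : ℝ} (hp : 1 < p) (hK : 1 ≤ K) (hγ0 : 0 ≤ γ)
    (hγ2 : γ ≤ 2) :
    ∃ C, 0 ≤ C ∧ ∀ r m δ u q, 0 < r → r ≤ 1 → u ≠ 0 → DiffBounds K r m δ u q →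
      |expansionError p r m δ u q| ≤ C * (r ^ (γ + 1) * (1 + |u| ^ (p - 2 - γ))) := by
  obtain ⟨C, hC, hlarge⟩ := exists_abs_expansionError_le_of_large hp hK
  refine ⟨C + (2 * (6 * K) ^ (p - 1) * (1 + (4 * K) ^ (-(p - 2 - γ))) +
    3 * (p - 1) * K * (4 * K) ^ γ), ?_, ?_⟩
  · have : 0 ≤ p - 1 := by linarith
    positivity
  intro r m δ u q hr hr1 hu0 h
  have hu : 0 < |u| := abs_pos.2 hu0
  have hp1 : 0 ≤ p - 1 := by linarith
  rcases lt_or_ge (4 * K * r) |u| with hcase | hcase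
  · have h1 : r ^ 3 * |u| ^ (p - 4) ≤ r ^ (γ + 1) * (1 + |u| ^ (p - 2 - γ)) := by
      have hru : r ≤ |u| := by nlinarith
      calc r ^ 3 * |u| ^ (p - 4) = r ^ (γ + 1) * (r ^ (2 - γ) * |u| ^ (p - 4)) := by
            rw [← mul_assoc, ← Real.rpow_add hr, ← Real.rpow_natCast]
            congr 2
            push_cast
            ring
        _ ≤ r ^ (γ + 1) * (|u| ^ (2 - γ) * |u| ^ (p - 4)) := by
            gcongr
        _ = r ^ (γ + 1) * |u| ^ (p - 2 - γ) := by
            rw [← Real.rpow_add hu]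
            congr 2
            ring
        _ ≤ _ := by
            gcongr
            linarith
    calc _ ≤ C * (r ^ 3 * |u| ^ (p - 4)) := hlarge r m δ u q hr hr1 h hcase
      _ ≤ C * (r ^ (γ + 1) * (1 + |u| ^ (p - 2 - γ))) := by gcongr
      _ ≤ _ := by
        gcongr
        exact le_add_of_nonneg_right (by positivity)
  · have h1 : r * |u| ^ (p - 2) ≤ (4 * K) ^ γ * (r ^ (γ + 1) * (1 + |u| ^ (p - 2 - γ))) := by
      calc r * |u| ^ (p - 2) = r * (|u| ^ γ * |u| ^ (p - 2 - γ)) := by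
            rw [← Real.rpow_add hu]
            congr 2
            ring
        _ ≤ r * ((4 * K * r) ^ γ * (1 + |u| ^ (p - 2 - γ))) := by
            gcongr
            linarith
        _ = _ := by
            rw [Real.mul_rpow (by linarith) hr.le, Real.rpow_add_one hr.ne']
            ring
    have h2 : r ^ (p - 1) ≤
        (1 + (4 * K) ^ (-(p - 2 - γ))) * (r ^ (γ + 1) * (1 + |u| ^ (p - 2 - γ))) := by
      have e : r ^ (p - 1) = r ^ (γ + 1) * r ^ (p - 2 - γ) := by
        rw [← Real.rpow_add hr]
        congr 1
        ring
      have e' : r ^ (p - 2 - γ) ≤ (1 + (4 * K) ^ (-(p - 2 - γ))) * (1 + |u| ^ (p - 2 - γ)) := by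
        have n1 : 0 ≤ (4 * K) ^ (-(p - 2 - γ)) := by positivity
        have n2 : 0 ≤ |u| ^ (p - 2 - γ) := by positivity
        -- For a nonnegative exponent the power of r is at most 1; for a negative one it is
        -- controlled through r ≥ |u|/(4K).
        rcases le_total 0 (p - 2 - γ) with hs | hs
        · have := Real.rpow_le_one hr.le hr1 hs
          nlinarith [mul_nonneg n1 n2]
        · have : r ^ (p - 2 - γ) ≤ (|u| / (4 * K)) ^ (p - 2 - γ) := by
            refine Real.rpow_le_rpow_of_nonpos (by positivity) ?_ hs
            rw [div_le_iff₀ (by positivity)]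
            linarith
          rw [Real.div_rpow hu.le (by positivity), div_eq_mul_inv,
            ← Real.rpow_neg (by positivity)] at this
          nlinarith [mul_nonneg n1 n2]
      rw [e]
      calc _ ≤ r ^ (γ + 1) * ((1 + (4 * K) ^ (-(p - 2 - γ))) * (1 + |u| ^ (p - 2 - γ))) := by
            gcongr
        _ = _ := by ring
    calc _ ≤ _ := abs_expansionError_le_of_small hp hK hr hr1 h hcase
      _ ≤ 2 * (6 * K) ^ (p - 1) *
          ((1 + (4 * K) ^ (-(p - 2 - γ))) * (r ^ (γ + 1) * (1 + |u| ^ (p - 2 - γ)))) +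
          3 * (p - 1) * K * ((4 * K) ^ γ * (r ^ (γ + 1) * (1 + |u| ^ (p - 2 - γ)))) := by
          gcongr
      _ = (2 * (6 * K) ^ (p - 1) * (1 + (4 * K) ^ (-(p - 2 - γ))) +
          3 * (p - 1) * K * (4 * K) ^ γ) * (r ^ (γ + 1) * (1 + |u| ^ (p - 2 - γ))) := by ring
      _ ≤ _ := by
        exact mul_le_mul_of_nonneg_right (le_add_of_nonneg_left hC) (by positivity)

theorem abs_expansionError_two_le (h : DiffBounds K r m δ u q) :
    |expansionError 2 r m δ u q| ≤ K * r ^ 3 := by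
  have : expansionError 2 r m δ u q = 2 * δ - r * q := by
    simp [expansionError, J]
    ring
  rw [this]
  exact h.diff

theorem abs_expansionError_three_le (hK : 1 ≤ K) (hr : 0 < r) (hr1 : r ≤ 1)
    (h : DiffBounds K r m δ u q) :
    |expansionError 3 r m δ u q| ≤
      96 * K ^ 2 * (r ^ 3 + if |u| ≤ 4 * K * r then r ^ 2 else 0) := by
  split_ifs with hu
  · refine (abs_expansionError_le_of_small (by norm_num) hK hr hr1 h hu).trans ?_
    norm_num
    nlinarith [mul_le_mul_of_nonneg_left hu (by positivity : 0 ≤ 6 * K * r),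
      (by positivity : 0 ≤ K ^ 2 * r ^ 3)]
  · rw [add_zero]
    rw [not_le] at hu
    wlog hpos : 0 < u generalizing m u
    · have hu0 : u ≠ 0 := by
        rintro rfl
        simp only [abs_zero] at hu
        have : 0 < 4 * K * r := by positivity
        linarith
      have := this h.neg (by rwa [abs_neg])
        (by rcases lt_or_gt_of_ne hu0 with h | h <;> [linarith; exact absurd h hpos])
      rwa [expansionError_neg] at this
    have hau := h.abs_u
    rw [abs_of_pos hpos] at hu hau
    have h3 : K * r ^ 2 ≤ K * r := by
      gcongr
      exact pow_le_of_le_one hr.le hr1 (by norm_num)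
    have hm := abs_le.1 h.mean
    have hδ := abs_le.1 h.abs_diff
    -- On positive arguments J_3 is the square, so the difference is exactly 4mδ and no negative
    -- power of u appears.
    have key : expansionError 3 r m δ u q = 4 * (m - u) * δ + 2 * u * (2 * δ - r * q) := by
      rw [expansionError, J_of_pos _ (by linarith), J_of_pos _ (by linarith), abs_of_pos hpos]
      norm_num
      ring
    rw [key]
    refine (abs_add_le _ _).trans ?_
    rw [abs_mul, abs_mul, abs_mul, abs_mul, abs_of_pos hpos, abs_two,
      abs_of_pos (by norm_num : (0 : ℝ) < 4)]
    calc _ ≤ 4 * (K * r ^ 2) * (K * r) + 2 * K * (K * r ^ 3) := by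
          gcongr
          exacts [h.mean, h.abs_diff, h.diff]
      _ ≤ _ := by nlinarith [(by positivity : 0 ≤ K ^ 2 * r ^ 3)]

end Pointwise

/-! ### Integrable majorants of the error on the sphere. -/

section Majorant

variable {d : ℕ} [NeZero d]

theorem toSphere_real_abs_mul_coord_le {s ε : ℝ} (hs : 0 < s) (hε : 0 ≤ ε) :
    (volume : Measure (EuclideanSpace ℝ (Fin d))).toSphere.real
      {ω : sphere (0 : EuclideanSpace ℝ (Fin d)) 1 |
        |s * (ω : EuclideanSpace ℝ (Fin d)) 0| ≤ ε} ≤ d * 2 ^ d * (ε / s) := by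
  have h : {ω : sphere (0 : EuclideanSpace ℝ (Fin d)) 1 |
      |s * (ω : EuclideanSpace ℝ (Fin d)) 0| ≤ ε} =
      {ω : sphere (0 : EuclideanSpace ℝ (Fin d)) 1 |
        |(ω : EuclideanSpace ℝ (Fin d)) 0| ≤ ε / s} := by
    ext ω
    simp only [mem_ofPred_eq]
    rw [abs_mul, abs_of_pos hs, le_div_iff₀ hs, mul_comm]
  rw [h]
  exact ENNReal.toReal_le_of_le_ofReal (by positivity) (toSphere_abs_coord_le (by positivity))

/-- The majorant B depends on the direction through u alone, so it can be rotated to the first axis.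
There u = sω_0 with s = |∇φ(z)|, and uniformity over s in [K⁻¹, K] is uniformity in z. The value u =
0 is excluded because a negative power of 0 is 0 by convention, not infinity; it concerns only a
null set. -/
theorem exists_expansionError_majorant {p γ K : ℝ} (hp : 1 < p) (hγ : AdmissibleOrder p γ)
    (hK : 1 ≤ K) :
    ∃ C, 0 ≤ C ∧ ∀ r, 0 < r → r ≤ 1 → ∃ B : ℝ → ℝ,
      (∀ m δ u q, u ≠ 0 → DiffBounds K r m δ u q → |expansionError p r m δ u q| ≤ B u) ∧
      ∀ s ∈ Icc K⁻¹ K,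
        Integrable (fun ω : sphere (0 : EuclideanSpace ℝ (Fin d)) 1 =>
          B (s * (ω : EuclideanSpace ℝ (Fin d)) 0))
          (volume : Measure (EuclideanSpace ℝ (Fin d))).toSphere ∧
        ∫ ω : sphere (0 : EuclideanSpace ℝ (Fin d)) 1, B (s * (ω : EuclideanSpace ℝ (Fin d)) 0)
          ∂(volume : Measure (EuclideanSpace ℝ (Fin d))).toSphere ≤ C * r ^ (γ + 1) := by
  set σ := (volume : Measure (EuclideanSpace ℝ (Fin d))).toSphere with hσ
  have hK0 : 0 < K := by linarith
  have hs0 : ∀ s ∈ Icc K⁻¹ K, 0 < s := fun s hs => (inv_pos.2 hK0).trans_le hs.1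
  have generic : 0 ≤ γ → γ ≤ 2 → γ < p - 1 → ∃ C, 0 ≤ C ∧ ∀ r, 0 < r → r ≤ 1 → ∃ B : ℝ → ℝ,
      (∀ m δ u q, u ≠ 0 → DiffBounds K r m δ u q → |expansionError p r m δ u q| ≤ B u) ∧
      ∀ s ∈ Icc K⁻¹ K, Integrable (fun ω : sphere (0 : EuclideanSpace ℝ (Fin d)) 1 =>
        B (s * (ω : EuclideanSpace ℝ (Fin d)) 0)) σ ∧
      ∫ ω : sphere (0 : EuclideanSpace ℝ (Fin d)) 1, B (s * (ω : EuclideanSpace ℝ (Fin d)) 0) ∂σ ≤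
        C * r ^ (γ + 1) := by
    intro h0 h2 h1
    obtain ⟨C, hC, hb⟩ := exists_abs_expansionError_le hp hK h0 h2
    have hI := integrable_sphere_abs_coord_rpow (d := d) (q := p - 2 - γ) (by linarith)
    have hI0 : 0 ≤ ∫ ω : sphere (0 : EuclideanSpace ℝ (Fin d)) 1,
        |(ω : EuclideanSpace ℝ (Fin d)) 0| ^ (p - 2 - γ) ∂σ :=
      integral_nonneg fun ω => by positivity
    refine ⟨C * (σ.real univ + K ^ |p - 2 - γ| * ∫ ω : sphere (0 : EuclideanSpace ℝ (Fin d)) 1,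
        |(ω : EuclideanSpace ℝ (Fin d)) 0| ^ (p - 2 - γ) ∂σ), by positivity, fun r hr hr1 =>
      ⟨fun u => C * (r ^ (γ + 1) * (1 + |u| ^ (p - 2 - γ))), fun m δ u q hu h =>
        hb r m δ u q hr hr1 hu h, fun s hs => ?_⟩⟩
    have hspos := hs0 s hs
    have hfun : ∀ ω : sphere (0 : EuclideanSpace ℝ (Fin d)) 1,
        C * (r ^ (γ + 1) * (1 + |s * (ω : EuclideanSpace ℝ (Fin d)) 0| ^ (p - 2 - γ))) =
        C * (r ^ (γ + 1) * (1 + s ^ (p - 2 - γ) *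
          |(ω : EuclideanSpace ℝ (Fin d)) 0| ^ (p - 2 - γ))) := fun ω => by
      rw [abs_mul, abs_of_pos hspos, Real.mul_rpow hspos.le (abs_nonneg _)]
    have hi2 := hI.const_mul (s ^ (p - 2 - γ))
    simp_rw [hfun]
    refine ⟨(((integrable_const 1).add hi2).const_mul _).const_mul _, ?_⟩
    rw [integral_const_mul, integral_const_mul, integral_add (integrable_const 1) hi2,
      integral_const_mul, integral_const, smul_eq_mul, mul_one]
    have hsK : s ^ (p - 2 - γ) ≤ K ^ |p - 2 - γ| := by
      rcases le_total 0 (p - 2 - γ) with h | h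
      · rw [abs_of_nonneg h]
        exact Real.rpow_le_rpow hspos.le hs.2 h
      · rw [abs_of_nonpos h, Real.rpow_neg hK0.le, ← Real.inv_rpow hK0.le]
        exact Real.rpow_le_rpow_of_nonpos (inv_pos.2 hK0) hs.1 h
    calc _ ≤ C * (r ^ (γ + 1) * (σ.real univ + K ^ |p - 2 - γ| *
          ∫ ω : sphere (0 : EuclideanSpace ℝ (Fin d)) 1,
            |(ω : EuclideanSpace ℝ (Fin d)) 0| ^ (p - 2 - γ) ∂σ)) := by gcongr
      _ = _ := by ring
  rcases hγ with ⟨h | h, rfl⟩ | ⟨hp23, hγ⟩ | ⟨hp12, hγ⟩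
  · subst h
    refine ⟨σ.real univ * K, by positivity, fun r hr hr1 => ⟨fun _ => K * r ^ 3,
      fun m δ u q _ h => abs_expansionError_two_le h, fun s _ => ⟨integrable_const _, ?_⟩⟩⟩
    rw [integral_const, smul_eq_mul, mul_assoc, show (2 : ℝ) + 1 = (3 : ℕ) by norm_num,
      Real.rpow_natCast]
  · rcases h.eq_or_lt with rfl | h
    · refine ⟨96 * K ^ 2 * (σ.real univ + d * 2 ^ d * (4 * K * K)), by positivity,
        fun r hr hr1 => ⟨fun u => 96 * K ^ 2 * (r ^ 3 + if |u| ≤ 4 * K * r then r ^ 2 else 0),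
        fun m δ u q _ h => abs_expansionError_three_le hK hr hr1 h, fun s hs => ?_⟩⟩
      have hspos := hs0 s hs
      have hm : MeasurableSet {ω : sphere (0 : EuclideanSpace ℝ (Fin d)) 1 |
          |s * (ω : EuclideanSpace ℝ (Fin d)) 0| ≤ 4 * K * r} := by
        refine (isClosed_le ?_ continuous_const).measurableSet
        fun_prop
      have hfun : ∀ ω : sphere (0 : EuclideanSpace ℝ (Fin d)) 1,
          (if |s * (ω : EuclideanSpace ℝ (Fin d)) 0| ≤ 4 * K * r then r ^ 2 else 0) =
          indicator {ω : sphere (0 : EuclideanSpace ℝ (Fin d)) 1 |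
            |s * (ω : EuclideanSpace ℝ (Fin d)) 0| ≤ 4 * K * r} (fun _ => r ^ 2) ω := fun ω => by
        simp [indicator_apply]
      have hi : Integrable (indicator {ω : sphere (0 : EuclideanSpace ℝ (Fin d)) 1 |
          |s * (ω : EuclideanSpace ℝ (Fin d)) 0| ≤ 4 * K * r} (fun _ => r ^ 2)) σ :=
        (integrable_const _).indicator hm
      simp_rw [hfun]
      refine ⟨((integrable_const _).add hi).const_mul _, ?_⟩
      rw [integral_const_mul, integral_add (integrable_const _) hi, integral_const,
        integral_indicator_const _ hm, smul_eq_mul, smul_eq_mul,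
        show (2 : ℝ) + 1 = (3 : ℕ) by norm_num, Real.rpow_natCast]
      have hsig := toSphere_real_abs_mul_coord_le (d := d) hspos
        (by positivity : 0 ≤ 4 * K * r)
      have hdiv : 4 * K * r / s ≤ 4 * K * K * r := by
        rw [div_eq_mul_inv]
        calc _ ≤ 4 * K * r * K := by
              gcongr
              exact inv_le_of_inv_le₀ hK0 hs.1
          _ = _ := by ring
      calc _ ≤ 96 * K ^ 2 * (σ.real univ * r ^ 3 + d * 2 ^ d * (4 * K * K * r) * r ^ 2) := by
            gcongr
            exact hsig.trans (by gcongr)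
        _ = _ := by ring
    · exact generic (by norm_num) le_rfl (by linarith)
  · exact generic (by linarith [hγ.1]) (by linarith [hγ.2]) hγ.2
  · exact generic hγ.1.le (by linarith [hγ.2]) hγ.2

end Majorant

/-! ### Restriction of φ to lines. -/

section Lines

variable {d : ℕ} {φ : EuclideanSpace ℝ (Fin d) → ℝ} {Ω : Set (EuclideanSpace ℝ (Fin d))}

theorem hasDerivAt_iteratedFDeriv_line {n k : ℕ} (hφ : ContDiffOn ℝ n φ Ω) (hΩ : IsOpen Ω)
    (hk : k < n) {z ω : EuclideanSpace ℝ (Fin d)} {t : ℝ} (ht : z + t • ω ∈ Ω) :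
    HasDerivAt (fun t : ℝ => iteratedFDeriv ℝ k φ (z + t • ω) fun _ => ω)
      (iteratedFDeriv ℝ (k + 1) φ (z + t • ω) fun _ => ω) t := by
  have h1 : HasFDerivAt (iteratedFDeriv ℝ k φ) (fderiv ℝ (iteratedFDeriv ℝ k φ) (z + t • ω))
      (z + t • ω) :=
    ((hφ.contDiffAt (hΩ.mem_nhds ht)).differentiableAt_iteratedFDeriv
      (by exact_mod_cast hk)).hasFDerivAt
  have h2 : HasDerivAt (fun t : ℝ => z + t • ω) ω t := by
    simpa using ((hasDerivAt_id t).smul_const ω).const_add z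
  have h3 := h1.comp_hasDerivAt t h2
  have h4 := ((ContinuousMultilinearMap.apply ℝ (fun _ : Fin k => EuclideanSpace ℝ (Fin d)) ℝ
    (fun _ => ω)).hasFDerivAt).comp_hasDerivAt t h3
  exact h4

theorem exists_hasFDerivAt_gradient (hφ : ContDiffOn ℝ 4 φ Ω) (hΩ : IsOpen Ω)
    {z : EuclideanSpace ℝ (Fin d)} (hz : z ∈ Ω) :
    ∃ H : EuclideanSpace ℝ (Fin d) →L[ℝ] EuclideanSpace ℝ (Fin d),
      HasFDerivAt (gradient φ) H z ∧
      ∀ w, inner ℝ (H w) w = iteratedFDeriv ℝ 2 φ z fun _ => w := by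
  -- The inverse Riesz map is conjugate-linear in general; over ℝ it is repackaged as a linear map,
  -- so that it can be composed with the derivative.
  let T : (EuclideanSpace ℝ (Fin d) →L[ℝ] ℝ) →L[ℝ] EuclideanSpace ℝ (Fin d) :=
    LinearMap.toContinuousLinearMap
      { toFun := (InnerProductSpace.toDual ℝ (EuclideanSpace ℝ (Fin d))).symm
        map_add' := fun a b => by simp
        map_smul' := fun a b => by simp }
  have hc : ContDiffAt ℝ 4 φ z := hφ.contDiffAt (hΩ.mem_nhds hz)
  have h1 : HasFDerivAt (fderiv ℝ φ) (fderiv ℝ (fderiv ℝ φ) z) z :=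
    ((hc.fderiv_right (m := 1) (by norm_num)).differentiableAt (by norm_num)).hasFDerivAt
  refine ⟨T.comp (fderiv ℝ (fderiv ℝ φ) z), T.hasFDerivAt.comp z h1, fun w => ?_⟩
  rw [iteratedFDeriv_two_apply]
  exact InnerProductSpace.toDual_symm_apply

theorem inner_gradient_eq (z w : EuclideanSpace ℝ (Fin d)) :
    inner ℝ (gradient φ z) w = iteratedFDeriv ℝ 1 φ z fun _ => w := by
  rw [iteratedFDeriv_one_apply]
  exact InnerProductSpace.toDual_symm_apply

theorem abs_iteratedFDeriv_apply_le {k : ℕ} {z ω : EuclideanSpace ℝ (Fin d)} {M : ℝ}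
    (hM : ‖iteratedFDeriv ℝ k φ z‖ ≤ M) (hω : ‖ω‖ = 1) :
    |iteratedFDeriv ℝ k φ z fun _ => ω| ≤ M := by
  have := (iteratedFDeriv ℝ k φ z).le_opNorm fun _ => ω
  simp only [hω, Finset.prod_const_one, mul_one] at this
  exact this.trans hM

/-- `odd_taylor` controls the mean and `even_taylor` the half-difference of t ↦ φ(z + tω); the
latter is where four derivatives are needed. -/
theorem diffBounds_of_contDiffOn (hφ : ContDiffOn ℝ 4 φ Ω) (hΩ : IsOpen Ω) {M K r : ℝ}
    (hM : ∀ j ≤ 4, ∀ z ∈ Ω, ‖iteratedFDeriv ℝ j φ z‖ ≤ M) (hMK : 2 * M ≤ K)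
    (hr : 0 < r) (hr1 : r ≤ 1) {z ω : EuclideanSpace ℝ (Fin d)} (hω : ‖ω‖ = 1)
    (hz : ∀ t ∈ Icc (-r) r, z + t • ω ∈ Ω) :
    DiffBounds K r ((φ (z + r • ω) - φ (z + (-r) • ω)) / (2 * r))
      ((φ (z + r • ω) + φ (z + (-r) • ω) - 2 * φ z) / (2 * r))
      (inner ℝ (gradient φ z) ω) (iteratedFDeriv ℝ 2 φ z fun _ => ω) := by
  have hz0 : z ∈ Ω := by simpa using hz 0 ⟨by linarith, hr.le⟩
  have hM0 : 0 ≤ M := (norm_nonneg _).trans (hM 0 (by norm_num) z hz0)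
  have hder : ∀ k < 4, ∀ t ∈ Icc (-r) r,
      HasDerivAt (fun t : ℝ => iteratedFDeriv ℝ k φ (z + t • ω) fun _ => ω)
      (iteratedFDeriv ℝ (k + 1) φ (z + t • ω) fun _ => ω) t := fun k hk t ht =>
    hasDerivAt_iteratedFDeriv_line (n := 4) hφ hΩ hk (hz t ht)
  have hbd : ∀ k ≤ 4, ∀ t ∈ Icc (-r) r, |iteratedFDeriv ℝ k φ (z + t • ω) fun _ => ω| ≤ M :=
    fun k hk t ht => abs_iteratedFDeriv_apply_le (hM k hk _ (hz t ht)) hω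
  have hodd := odd_taylor (hder 0 (by norm_num)) (hder 1 (by norm_num)) (hder 2 (by norm_num))
    (hbd 3 (by norm_num)) r ⟨hr.le, le_rfl⟩
  have heven := even_taylor (hder 0 (by norm_num)) (hder 1 (by norm_num)) (hder 2 (by norm_num))
    (hder 3 (by norm_num)) (hbd 4 le_rfl) r ⟨hr.le, le_rfl⟩
  simp only [iteratedFDeriv_zero_apply, zero_smul, add_zero, Nat.reduceAdd] at hodd heven
  rw [← inner_gradient_eq] at hodd
  have hu : |inner ℝ (gradient φ z) ω| ≤ M := by
    rw [inner_gradient_eq]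
    exact abs_iteratedFDeriv_apply_le (hM 1 (by norm_num) z hz0) hω
  have hq : |iteratedFDeriv ℝ 2 φ z fun _ => ω| ≤ M :=
    abs_iteratedFDeriv_apply_le (hM 2 (by norm_num) z hz0) hω
  set A := φ (z + r • ω)
  set A' := φ (z + (-r) • ω)
  set u := inner ℝ (gradient φ z) ω
  set q := iteratedFDeriv ℝ 2 φ z fun _ => ω
  have hdiff : |2 * ((A + A' - 2 * φ z) / (2 * r)) - r * q| ≤ 2 * M * r ^ 3 := by
    have e : 2 * ((A + A' - 2 * φ z) / (2 * r)) - r * q = (A + A' - 2 * φ z - r ^ 2 * q) / r := by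
      field_simp
    rw [e, abs_div, abs_of_pos hr, div_le_iff₀ hr]
    linarith
  refine ⟨by linarith, ?_, ?_, ?_⟩
  · have e : (A - A') / (2 * r) - u = (A - A' - 2 * r * u) / (2 * r) := by field_simp
    rw [e, abs_div, abs_of_pos (by positivity : 0 < 2 * r), div_le_iff₀ (by positivity)]
    nlinarith [pow_pos hr 3]
  · refine hdiff.trans ?_
    gcongr
  · have h3 : r ^ 3 ≤ r := pow_le_of_le_one hr.le hr1 (by norm_num)
    have h4 := abs_le.1 hdiff
    have h5 := abs_le.1 hq
    have h6 : M * r ^ 3 ≤ M * r := by gcongr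
    have h7 : 2 * M * r ≤ K * r := by gcongr
    have h8 : r * q ≤ r * M := by gcongr; exact h5.2
    have h9 : r * (-M) ≤ r * q := by gcongr; exact h5.1
    rw [abs_le]
    constructor <;> nlinarith

end Lines

/-! ### The expansion of spherical averages. -/

section SphereEstimate

variable {d : ℕ} [NeZero d]

omit [NeZero d] in
theorem sphereAverage_eq (r : ℝ) (f : EuclideanSpace ℝ (Fin d) → ℝ) :
    sphereAverage r f = ((volume : Measure (EuclideanSpace ℝ (Fin d))).toSphere.real univ)⁻¹ *
      ∫ ω : sphere (0 : EuclideanSpace ℝ (Fin d)) 1, f (r • (ω : EuclideanSpace ℝ (Fin d)))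
        ∂(volume : Measure (EuclideanSpace ℝ (Fin d))).toSphere := by
  rw [sphereAverage, average_eq, smul_eq_mul]

theorem toSphere_real_univ_pos :
    0 < (volume : Measure (EuclideanSpace ℝ (Fin d))).toSphere.real univ :=
  ENNReal.toReal_pos (Measure.measure_univ_ne_zero.2 (Measure.toSphere_ne_zero _))
    (measure_ne_top _ _)

theorem kappa_eq (p : ℝ) :
    kappa p d = 2 * (volume : Measure (EuclideanSpace ℝ (Fin d))).toSphere.real univ /
      sphereMoment d p 0 0 := by
  rw [kappa, sphereAverage_eq, sphereMoment_zero]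
  simp only [one_smul, mul_inv, inv_inv]
  ring

theorem kappa_pos {p : ℝ} (hp : 1 < p) : 0 < kappa p d := by
  rw [kappa_eq]
  have := sphereMoment_zero_pos (d := d) hp
  have := toSphere_real_univ_pos (d := d)
  positivity

omit [NeZero d] in
theorem integral_sphere_neg (f : EuclideanSpace ℝ (Fin d) → ℝ) :
    ∫ ω : sphere (0 : EuclideanSpace ℝ (Fin d)) 1, f (-ω)
      ∂(volume : Measure (EuclideanSpace ℝ (Fin d))).toSphere =
    ∫ ω : sphere (0 : EuclideanSpace ℝ (Fin d)) 1, f ω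
      ∂(volume : Measure (EuclideanSpace ℝ (Fin d))).toSphere :=
  integral_sphere_comp (LinearIsometryEquiv.neg ℝ) f

/-- The core estimate: symmetrise in ω, recognise the leading term as the p-Laplacian, and integrate
the majorant of the error. -/
theorem exists_sphere_estimate {p γ : ℝ} (hp : 1 < p) (hγ : AdmissibleOrder p γ)
    {φ : EuclideanSpace ℝ (Fin d) → ℝ} {Ω : Set (EuclideanSpace ℝ (Fin d))}
    (hφ : ContDiffOn ℝ 4 φ Ω) (hΩ : IsOpen Ω) {M c : ℝ}
    (hM : ∀ j ≤ 4, ∀ z ∈ Ω, ‖iteratedFDeriv ℝ j φ z‖ ≤ M) (hc : 0 < c) :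
    ∃ C, 0 ≤ C ∧ ∀ z r, 0 < r → r ≤ 1 → closedBall z r ⊆ Ω → c ≤ ‖gradient φ z‖ →
      |sphereAverage r (fun y => J p (φ (z + y) - φ z)) - r ^ p * (pLaplacian p φ z / kappa p d)| ≤
        C * r ^ (p + γ) := by
  set σ := (volume : Measure (EuclideanSpace ℝ (Fin d))).toSphere with hσ
  have hσ0 : 0 < σ.real univ := toSphere_real_univ_pos
  have hm0 := sphereMoment_zero_pos (d := d) hp
  -- 2M ≤ K serves the Taylor bounds; with c⁻¹ ≤ K it also puts |∇φ(z)| in [K⁻¹, K].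
  let K : ℝ := max 1 (max (2 * M) c⁻¹)
  have hK1 : 1 ≤ K := le_max_left _ _
  have hKM : 2 * M ≤ K := (le_max_left _ _).trans (le_max_right _ _)
  have hKc : K⁻¹ ≤ c := inv_le_of_inv_le₀ hc ((le_max_right _ _).trans (le_max_right _ _))
  obtain ⟨C, hC, hmaj⟩ := exists_expansionError_majorant (d := d) hp hγ hK1
  refine ⟨(σ.real univ)⁻¹ * (C / 2), by positivity, fun z r hr hr1 hball hgrad => ?_⟩
  obtain ⟨B, hB, hBint⟩ := hmaj r hr hr1
  have hz : z ∈ Ω := hball (mem_closedBall_self hr.le)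
  set v := gradient φ z with hv
  have hv0 : v ≠ 0 := norm_pos_iff.1 (hc.trans_le hgrad)
  have hM0 : 0 ≤ M := (norm_nonneg _).trans (hM 0 (by norm_num) z hz)
  have hvM : ‖v‖ ≤ M := by
    have h1 := hM 1 (by norm_num) z hz
    rw [norm_iteratedFDeriv_one] at h1
    rwa [hv, gradient, LinearIsometryEquiv.norm_map]
  obtain ⟨H, hH, hHq⟩ := exists_hasFDerivAt_gradient hφ hΩ hz
  have hmem : ∀ ω : sphere (0 : EuclideanSpace ℝ (Fin d)) 1, ∀ t ∈ Icc (-r) r,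
      z + t • (ω : EuclideanSpace ℝ (Fin d)) ∈ Ω := fun ω t ht => by
    apply hball
    rw [mem_closedBall, dist_self_add_left, norm_smul, norm_eq_of_mem_sphere, mul_one]
    exact abs_le.2 ht
  have hdb : ∀ ω : sphere (0 : EuclideanSpace ℝ (Fin d)) 1, _ := fun ω =>
    diffBounds_of_contDiffOn hφ hΩ hM hKM hr hr1 (norm_eq_of_mem_sphere ω) (hmem ω)
  simp only [← hHq, ← hv] at hdb
  let m : sphere (0 : EuclideanSpace ℝ (Fin d)) 1 → ℝ := fun ω =>
    (φ (z + r • (ω : EuclideanSpace ℝ (Fin d))) - φ (z + (-r) • (ω : EuclideanSpace ℝ (Fin d)))) /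
      (2 * r)
  let δ : sphere (0 : EuclideanSpace ℝ (Fin d)) 1 → ℝ := fun ω =>
    (φ (z + r • (ω : EuclideanSpace ℝ (Fin d))) + φ (z + (-r) • (ω : EuclideanSpace ℝ (Fin d))) -
      2 * φ z) / (2 * r)
  let u : sphere (0 : EuclideanSpace ℝ (Fin d)) 1 → ℝ := fun ω =>
    inner ℝ v (ω : EuclideanSpace ℝ (Fin d))
  let q : sphere (0 : EuclideanSpace ℝ (Fin d)) 1 → ℝ := fun ω =>
    inner ℝ (H ω) (ω : EuclideanSpace ℝ (Fin d))
  let g : EuclideanSpace ℝ (Fin d) → ℝ := fun y => J p (φ (z + y) - φ z)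
  obtain ⟨L, hL⟩ := exists_linearIsometryEquiv_inner hv0
  have hgi : ∀ t ∈ Icc (-r) r, Integrable (fun ω : sphere (0 : EuclideanSpace ℝ (Fin d)) 1 =>
      g (t • (ω : EuclideanSpace ℝ (Fin d)))) σ := fun t ht => by
    refine Continuous.integrable_of_hasCompactSupport ?_ (HasCompactSupport.of_compactSpace _)
    refine (continuous_J hp).comp (Continuous.sub ?_ continuous_const)
    exact hφ.continuousOn.comp_continuous (by fun_prop) fun ω => hmem ω t ht
  have hui : Integrable (fun ω => |u ω| ^ (p - 2) * q ω) σ := by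
    rw [← integrable_sphere_comp L (f := fun ω => |inner ℝ v ω| ^ (p - 2) * inner ℝ (H ω) ω)]
    simp_rw [hL, abs_mul, Real.mul_rpow (abs_nonneg _) (abs_nonneg _), mul_assoc]
    refine Integrable.const_mul ?_ _
    refine (integrable_sphere_abs_coord_rpow (by linarith)).mul_bdd (c := ‖H‖) ?_ ?_
    · refine Continuous.aestronglyMeasurable ?_
      fun_prop
    · refine .of_forall fun ω => ?_
      refine (norm_inner_le_norm _ _).trans ?_
      have := H.le_opNorm (L ω)
      simp only [LinearIsometryEquiv.norm_map, norm_eq_of_mem_sphere, mul_one] at this ⊢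
      exact this
  have hpt : ∀ ω : sphere (0 : EuclideanSpace ℝ (Fin d)) 1,
      g (r • (ω : EuclideanSpace ℝ (Fin d))) + g ((-r) • (ω : EuclideanSpace ℝ (Fin d)))
      = r ^ (p - 1) * (expansionError p r (m ω) (δ ω) (u ω) (q ω) +
        (p - 1) * r * (|u ω| ^ (p - 2) * q ω)) := fun ω => by
    have e1 : φ (z + r • (ω : EuclideanSpace ℝ (Fin d))) - φ z = r * (m ω + δ ω) := by
      simp only [m, δ]; field_simp; ring
    have e2 : φ (z + (-r) • (ω : EuclideanSpace ℝ (Fin d))) - φ z = -(r * (m ω - δ ω)) := by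
      simp only [m, δ]; field_simp; ring
    simp only [g]
    rw [e1, e2, J_neg, J_mul p hr, J_mul p hr, expansionError]
    ring
  -- Integrability comes from solving `hpt` for the error, all other terms being integrable.
  have hErr : Integrable (fun ω => expansionError p r (m ω) (δ ω) (u ω) (q ω)) σ := by
    have h1 := (((hgi r ⟨by linarith, le_rfl⟩).add (hgi (-r) ⟨le_rfl, by linarith⟩)).const_mul
      (r ^ (p - 1))⁻¹).sub (hui.const_mul ((p - 1) * r))
    refine h1.congr (.of_forall fun ω => ?_)
    have hr' : r ^ (p - 1) ≠ 0 := (Real.rpow_pos_of_pos hr _).ne'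
    simp only [Pi.sub_apply, Pi.add_apply]
    rw [hpt ω, inv_mul_cancel_left₀ hr']
    ring
  have hErrLe : |∫ ω, expansionError p r (m ω) (δ ω) (u ω) (q ω) ∂σ| ≤ C * r ^ (γ + 1) := by
    have hs := hBint ‖v‖ ⟨hKc.trans hgrad, by linarith⟩
    have hcomp := integral_sphere_comp L fun ω => B (inner ℝ v ω)
    have hicomp := integrable_sphere_comp L (f := fun ω => B (inner ℝ v ω))
    simp_rw [hL] at hcomp hicomp
    rw [← Real.norm_eq_abs]
    refine (norm_integral_le_of_norm_le (g := fun ω => B (u ω)) (hicomp.1 hs.1) ?_).trans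
      (hcomp.symm.trans_le hs.2)
    have hne : ∀ᵐ ω ∂σ, u ω ≠ 0 := by
      have h0 := ae_toSphere_coord_ne_zero (d := d)
      have h1 := (measurePreserving_sphereHomeomorph L.symm).quasiMeasurePreserving.ae h0
      filter_upwards [h1] with ω hω
      have := hL (L.symm ω)
      rw [LinearIsometryEquiv.apply_symm_apply] at this
      change inner ℝ v (ω : EuclideanSpace ℝ (Fin d)) ≠ 0
      rw [this]
      exact mul_ne_zero (norm_ne_zero_iff.2 hv0) hω
    filter_upwards [hne] with ω hω
    exact hB _ _ _ _ hω (hdb ω)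
  have hsym : ∫ ω : sphere (0 : EuclideanSpace ℝ (Fin d)) 1,
      g (r • (ω : EuclideanSpace ℝ (Fin d))) ∂σ = 1 / 2 * (r ^ (p - 1) *
        (∫ ω, expansionError p r (m ω) (δ ω) (u ω) (q ω) ∂σ +
          r * (sphereMoment d p 0 0 * pLaplacian p φ z))) := by
    have h1 := integral_sphere_neg (d := d) fun ω => g (r • ω)
    simp only [smul_neg, ← neg_smul] at h1
    have h2 := integral_add (hgi r ⟨by linarith, le_rfl⟩) (hgi (-r) ⟨le_rfl, by linarith⟩)
    simp_rw [hpt] at h2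
    rw [h1, integral_const_mul, integral_add hErr (hui.const_mul _), integral_const_mul,
      mul_comm (p - 1) r, mul_assoc, sphere_integral_main hp hv0 H] at h2
    rw [pLaplacian_eq hH hv0]
    linarith
  have hfin : sphereAverage r (fun y => J p (φ (z + y) - φ z)) -
      r ^ p * (pLaplacian p φ z / kappa p d) = (σ.real univ)⁻¹ * (1 / 2 * (r ^ (p - 1) *
        ∫ ω, expansionError p r (m ω) (δ ω) (u ω) (q ω) ∂σ)) := by
    rw [sphereAverage_eq, hsym, kappa_eq, ← hσ]
    have : r ^ p = r ^ (p - 1) * r := by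
      rw [← Real.rpow_add_one hr.ne']
      ring_nf
    rw [this]
    field_simp
    ring
  rw [hfin, abs_mul, abs_mul, abs_mul, abs_of_pos (inv_pos.2 hσ0),
    abs_of_pos (Real.rpow_pos_of_pos hr _), abs_of_pos (by norm_num : (0 : ℝ) < 1 / 2)]
  calc _ ≤ (σ.real univ)⁻¹ * (1 / 2 * (r ^ (p - 1) * (C * r ^ (γ + 1)))) := by gcongr
    _ = (σ.real univ)⁻¹ * (C / 2) * (r ^ (p - 1) * r ^ (γ + 1)) := by ring
    _ = _ := by
      rw [← Real.rpow_add hr]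
      ring_nf

end SphereEstimate

/-! ### Weighted radial integrals of functions close to a power. -/

section PowerIntegrals

theorem integrableOn_Ioo_rpow {q : ℝ} (hq : -1 < q) (r : ℝ) :
    IntegrableOn (fun t : ℝ => t ^ q) (Ioo 0 r) := by
  rcases le_total r 0 with hr | hr
  · simp [Ioo_eq_empty_of_le hr]
  · exact ((intervalIntegral.intervalIntegrable_rpow' (a := 0) (b := r) hq).1).mono_set
      Ioo_subset_Ioc_self

theorem integral_Ioo_rpow {q r : ℝ} (hq : -1 < q) (hr : 0 < r) :
    ∫ t in Ioo 0 r, t ^ q = r ^ (q + 1) / (q + 1) := by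
  rw [← integral_Ioc_eq_integral_Ioo, ← intervalIntegral.integral_of_le hr.le,
    integral_rpow (Or.inl hq), Real.zero_rpow (by linarith), sub_zero]

variable {T : ℝ → ℝ} {Λ C p γ r : ℝ}

theorem integrableOn_rpow_mul {q : ℝ} (hq : -1 < q + p) (hγ : 0 ≤ γ)
    (hT : AEStronglyMeasurable T (volume.restrict (Ioo 0 r)))
    (h : ∀ t ∈ Ioo 0 r, |T t - Λ * t ^ p| ≤ C * t ^ (p + γ)) :
    IntegrableOn (fun t => t ^ q * T t) (Ioo 0 r) := by
  have hb : IntegrableOn (fun t => |Λ| * t ^ (q + p) + C * t ^ (q + p + γ)) (Ioo 0 r) :=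
    ((integrableOn_Ioo_rpow hq r).const_mul _).add
      ((integrableOn_Ioo_rpow (by linarith : -1 < q + p + γ) r).const_mul _)
  refine Integrable.mono' hb ?_ ?_
  · exact (measurable_id.pow_const q).aestronglyMeasurable.mul hT
  · filter_upwards [ae_restrict_mem measurableSet_Ioo] with t ht
    have ht0 := ht.1
    have h1 : |T t| ≤ |Λ| * t ^ p + C * t ^ (p + γ) := by
      have h2 := abs_sub_abs_le_abs_sub (T t) (Λ * t ^ p)
      rw [abs_mul, abs_of_pos (Real.rpow_pos_of_pos ht0 p)] at h2
      linarith [h t ht]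
    rw [norm_mul, Real.norm_eq_abs, Real.norm_eq_abs, abs_of_pos (Real.rpow_pos_of_pos ht0 q)]
    calc _ ≤ t ^ q * (|Λ| * t ^ p + C * t ^ (p + γ)) := by gcongr
      _ = _ := by
        rw [add_assoc q, Real.rpow_add ht0 q, Real.rpow_add ht0 q]
        ring

/-- Applied with T(t) the spherical average: q = d-1 gives ball integrals and q = -1-sp the
fractional kernel. -/
theorem abs_integral_rpow_mul_sub_le {q : ℝ} (hq : -1 < q + p) (hγ : 0 ≤ γ) (hr : 0 < r)
    (hT : AEStronglyMeasurable T (volume.restrict (Ioo 0 r)))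
    (h : ∀ t ∈ Ioo 0 r, |T t - Λ * t ^ p| ≤ C * t ^ (p + γ)) :
    |(∫ t in Ioo 0 r, t ^ q * T t) - Λ * (r ^ (q + p + 1) / (q + p + 1))| ≤
      C * (r ^ (q + p + γ + 1) / (q + p + γ + 1)) := by
  have hi1 := integrableOn_rpow_mul hq hγ hT h
  have hi2 := (integrableOn_Ioo_rpow hq r).const_mul Λ
  rw [← integral_Ioo_rpow hq hr, ← integral_const_mul, ← integral_sub hi1 hi2,
    ← integral_Ioo_rpow (by linarith : -1 < q + p + γ) hr, ← integral_const_mul, ← Real.norm_eq_abs]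
  refine norm_integral_le_of_norm_le
    ((integrableOn_Ioo_rpow (by linarith : -1 < q + p + γ) r).const_mul _) ?_
  filter_upwards [ae_restrict_mem measurableSet_Ioo] with t ht
  have ht0 := ht.1
  have e : t ^ q * T t - Λ * t ^ (q + p) = t ^ q * (T t - Λ * t ^ p) := by
    rw [Real.rpow_add ht0]
    ring
  rw [e, norm_mul, Real.norm_eq_abs, Real.norm_eq_abs, abs_of_pos (Real.rpow_pos_of_pos ht0 q),
    add_assoc q, Real.rpow_add ht0 q]
  calc _ ≤ t ^ q * (C * t ^ (p + γ)) := by gcongr; exact h t ht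
    _ = _ := by ring

end PowerIntegrals

/-! ### Ball integrals from spherical averages. -/

section Solid

variable {d : ℕ} [NeZero d]

theorem indicator_integral_sphere (w : ℝ → ℝ) (g : EuclideanSpace ℝ (Fin d) → ℝ) (A : Set ℝ)
    {t : ℝ} (ht : 0 < t) :
    ∫ ω : sphere (0 : EuclideanSpace ℝ (Fin d)) 1,
      indicator {y : EuclideanSpace ℝ (Fin d) | ‖y‖ ∈ A} (fun y => w ‖y‖ * g y)
        (t • (ω : EuclideanSpace ℝ (Fin d)))
      ∂(volume : Measure (EuclideanSpace ℝ (Fin d))).toSphere =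
    indicator A (fun t => w t * ((volume : Measure (EuclideanSpace ℝ (Fin d))).toSphere.real univ *
      sphereAverage t g)) t := by
  have hn : ∀ ω : sphere (0 : EuclideanSpace ℝ (Fin d)) 1,
      ‖t • (ω : EuclideanSpace ℝ (Fin d))‖ = t := fun ω => by
    rw [norm_smul, norm_eq_of_mem_sphere, mul_one, Real.norm_of_nonneg ht.le]
  have hav : (volume : Measure (EuclideanSpace ℝ (Fin d))).toSphere.real univ * sphereAverage t g =
      ∫ ω : sphere (0 : EuclideanSpace ℝ (Fin d)) 1, g (t • (ω : EuclideanSpace ℝ (Fin d)))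
        ∂(volume : Measure (EuclideanSpace ℝ (Fin d))).toSphere := by
    rw [sphereAverage_eq, mul_inv_cancel_left₀ toSphere_real_univ_pos.ne']
  by_cases hA : t ∈ A
  · rw [indicator_of_mem hA, hav, ← integral_const_mul]
    simp [indicator, hn, hA]
  · simp [indicator, hn, hA]

/-- Polar coordinates on an annular region, in terms of averages over spheres. -/
theorem setIntegral_norm_mem_eq {w : ℝ → ℝ} {g : EuclideanSpace ℝ (Fin d) → ℝ} {A : Set ℝ}
    (hA : MeasurableSet A)
    (h : IntegrableOn (fun y => w ‖y‖ * g y) {y : EuclideanSpace ℝ (Fin d) | ‖y‖ ∈ A}) :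
    ∫ y in {y : EuclideanSpace ℝ (Fin d) | ‖y‖ ∈ A}, w ‖y‖ * g y =
      (volume : Measure (EuclideanSpace ℝ (Fin d))).toSphere.real univ *
        ∫ t in Ioi 0 ∩ A, t ^ (d - 1) * (w t * sphereAverage t g) := by
  have hm : MeasurableSet {y : EuclideanSpace ℝ (Fin d) | ‖y‖ ∈ A} := measurable_norm hA
  rw [← integral_indicator hm,
    integral_eq_integral_Ioi_integral_sphere _ ((integrable_indicator_iff hm).2 h),
    finrank_euclideanSpace_fin, ← integral_const_mul, ← setIntegral_indicator hA]
  refine setIntegral_congr_fun measurableSet_Ioi fun t ht => ?_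
  simp only [indicator_integral_sphere w g A ht]
  by_cases htA : t ∈ A
  · simp only [indicator_of_mem htA]
    ring
  · simp [indicator_of_notMem htA]

theorem integrableOn_norm_mem {w : ℝ → ℝ} {g : EuclideanSpace ℝ (Fin d) → ℝ} {A : Set ℝ}
    (hA : MeasurableSet A)
    (h : IntegrableOn (fun y => w ‖y‖ * g y) {y : EuclideanSpace ℝ (Fin d) | ‖y‖ ∈ A}) :
    IntegrableOn (fun t => t ^ (d - 1) * (w t * sphereAverage t g)) (Ioi 0 ∩ A) := by
  have hm : MeasurableSet {y : EuclideanSpace ℝ (Fin d) | ‖y‖ ∈ A} := measurable_norm hA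
  have h1 := (integrableOn_Ioi_integral_sphere _ ((integrable_indicator_iff hm).2 h)).const_mul
    ((volume : Measure (EuclideanSpace ℝ (Fin d))).toSphere.real univ)⁻¹
  rw [finrank_euclideanSpace_fin] at h1
  refine IntegrableOn.congr_fun (IntegrableOn.mono_set h1 inter_subset_left) (fun t ht => ?_)
    (measurableSet_Ioi.inter hA)
  have hne := (toSphere_real_univ_pos (d := d)).ne'
  simp only [indicator_integral_sphere w g A ht.1, indicator_of_mem ht.2]
  field_simp

omit [NeZero d] in
theorem ball_eq_norm_mem (r : ℝ) :
    ball (0 : EuclideanSpace ℝ (Fin d)) r = {y | ‖y‖ ∈ Iio r} := by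
  ext y; simp

theorem setIntegral_ball_eq {g : EuclideanSpace ℝ (Fin d) → ℝ} {r : ℝ}
    (h : IntegrableOn g (ball 0 r)) :
    ∫ y in ball 0 r, g y = (volume : Measure (EuclideanSpace ℝ (Fin d))).toSphere.real univ *
      ∫ t in Ioo 0 r, t ^ ((d : ℝ) - 1) * sphereAverage t g := by
  have h1 := setIntegral_norm_mem_eq (w := fun _ => 1) (g := g) (A := Iio r) measurableSet_Iio
    (by simpa only [one_mul, ← ball_eq_norm_mem] using h)
  simp only [one_mul, Ioi_inter_Iio, ← ball_eq_norm_mem] at h1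
  rw [h1]
  congr 1
  refine setIntegral_congr_fun measurableSet_Ioo fun t _ => ?_
  rw [← Nat.cast_pred (NeZero.pos d), Real.rpow_natCast]

/-- Fubini gives measurability of t^(d-1) times the average; the factor is nonzero for t > 0 and is
divided out. -/
theorem aestronglyMeasurable_sphereAverage {g : EuclideanSpace ℝ (Fin d) → ℝ} {r : ℝ}
    (h : IntegrableOn g (ball 0 r)) :
    AEStronglyMeasurable (fun t => sphereAverage t g) (volume.restrict (Ioo 0 r)) := by
  have h1 := integrableOn_norm_mem (w := fun _ => 1) (g := g) (A := Iio r) measurableSet_Iio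
    (by simpa only [one_mul, ← ball_eq_norm_mem] using h)
  simp only [one_mul, Ioi_inter_Iio] at h1
  have h2 : AEStronglyMeasurable (fun t : ℝ => (t ^ (d - 1))⁻¹ * (t ^ (d - 1) * sphereAverage t g))
      (volume.restrict (Ioo 0 r)) :=
    (measurable_id.pow_const (d - 1)).inv.aestronglyMeasurable.mul h1.aestronglyMeasurable
  refine h2.congr ?_
  filter_upwards [ae_restrict_mem measurableSet_Ioo] with t ht
  exact inv_mul_cancel_left₀ (pow_pos ht.1 _).ne' _

theorem volume_real_ball {r : ℝ} (hr : 0 < r) :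
    volume.real (ball (0 : EuclideanSpace ℝ (Fin d)) r) =
      r ^ d * ((volume : Measure (EuclideanSpace ℝ (Fin d))).toSphere.real univ / d) := by
  have hd : (d : ℝ) ≠ 0 := NeZero.ne _
  rw [Measure.toSphere_real_apply_univ, finrank_euclideanSpace_fin, mul_div_cancel_left₀ _ hd,
    measureReal_def, Measure.addHaar_ball_of_pos _ _ hr, finrank_euclideanSpace_fin,
    ENNReal.toReal_mul, ENNReal.toReal_ofReal (by positivity), measureReal_def]

theorem meanBall_eq {p r : ℝ} (hr : 0 < r) {φ : EuclideanSpace ℝ (Fin d) → ℝ}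
    {z : EuclideanSpace ℝ (Fin d)}
    (h : IntegrableOn (fun y => J p (φ (z + y) - φ z)) (ball 0 r)) :
    meanBall p r φ z = (p + d) * kappa p d / r ^ (p + d) *
      ∫ t in Ioo 0 r, t ^ ((d : ℝ) - 1) * sphereAverage t fun y => J p (φ (z + y) - φ z) := by
  have hd : (d : ℝ) ≠ 0 := NeZero.ne _
  have hne := (toSphere_real_univ_pos (d := d)).ne'
  rw [meanBall, setAverage_eq, smul_eq_mul, setIntegral_ball_eq h, volume_real_ball hr,
    Real.rpow_add hr, Real.rpow_natCast]
  have := (Real.rpow_pos_of_pos hr p).ne'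
  field_simp

end Solid

/-! ### The principal value defining the fractional p-Laplacian. -/

section Fractional

variable {d : ℕ} [NeZero d] {s p r : ℝ} {φ : EuclideanSpace ℝ (Fin d) → ℝ}
  {z : EuclideanSpace ℝ (Fin d)}

omit [NeZero d] in
-- Off B_ε the numerator is bounded and |y| is comparable to 1 + |y|, whose power -(d+sp) is
-- integrable because sp > 0.
theorem integrableOn_fracIntegrand (hs : 0 < s) (hp : 1 < p) (hφ : MemLp φ ⊤ volume) {ε : ℝ}
    (hε : 0 < ε) : IntegrableOn (fracIntegrand s p φ z) (ball 0 ε)ᶜ := by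
  have hcomp : MemLp (fun y => φ (z + y)) ⊤ volume :=
    hφ.comp_measurePreserving (measurePreserving_add_left volume z)
  have hsub : MemLp (fun y => φ (z + y) - φ z) ⊤ volume := hcomp.sub (memLp_top_const _)
  obtain ⟨N, hN⟩ : ∃ N, ∀ᵐ y, |φ (z + y) - φ z| ≤ N := by
    have := hsub.eLpNorm_lt_top
    refine ⟨(eLpNorm (fun y => φ (z + y) - φ z) ⊤ volume).toReal, ?_⟩
    filter_upwards [enorm_ae_le_eLpNormEssSup (fun y => φ (z + y) - φ z) volume] with y hy
    rw [← eLpNorm_exponent_top] at hy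
    have := ENNReal.toReal_mono this.ne hy
    simpa using this
  have hq : ((Module.finrank ℝ (EuclideanSpace ℝ (Fin d)) : ℕ) : ℝ) < d + s * p := by
    rw [finrank_euclideanSpace_fin]
    have : 0 < s * p := by positivity
    linarith
  have hq0 : 0 < d + s * p := (Nat.cast_nonneg _).trans_lt hq
  have hbd := ((integrable_one_add_norm (μ := (volume : Measure (EuclideanSpace ℝ (Fin d)))) hq
    ).const_mul (N ^ (p - 1) * (1 / ε + 1) ^ (d + s * p))).integrableOn (s := (ball 0 ε)ᶜ)
  refine Integrable.mono' hbd ?_ ?_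
  · refine AEStronglyMeasurable.restrict ?_
    change AEStronglyMeasurable
      (fun y => J p (φ (z + y) - φ z) / ‖y‖ ^ (d + s * p)) volume
    simp only [div_eq_mul_inv]
    exact ((continuous_J hp).comp_aestronglyMeasurable hsub.1).mul
      (measurable_norm.pow_const _).inv.aestronglyMeasurable
  · filter_upwards [ae_restrict_mem measurableSet_ball.compl, ae_restrict_of_ae hN] with y hy hNy
    have hy' : ε ≤ ‖y‖ := by simpa using hy
    have hy0 : 0 < ‖y‖ := hε.trans_le hy'
    have h1 : 1 + ‖y‖ ≤ (1 / ε + 1) * ‖y‖ := by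
      have : 1 ≤ 1 / ε * ‖y‖ := by
        rw [one_div, ← div_eq_inv_mul, le_div_iff₀ hε]
        linarith
      linarith
    rw [fracIntegrand, norm_div, Real.norm_eq_abs, Real.norm_eq_abs, abs_J hp,
      abs_of_pos (Real.rpow_pos_of_pos hy0 _)]
    have h2 : (1 + ‖y‖) ^ (d + s * p) ≤ (1 / ε + 1) ^ (d + s * p) * ‖y‖ ^ (d + s * p) := by
      rw [← Real.mul_rpow (by positivity) hy0.le]
      exact Real.rpow_le_rpow (by positivity) h1 hq0.le
    have hN0 : 0 ≤ N := (abs_nonneg _).trans hNy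
    rw [Real.rpow_neg (by positivity), div_le_iff₀ (Real.rpow_pos_of_pos hy0 _), mul_assoc,
      mul_assoc]
    calc |φ (z + y) - φ z| ^ (p - 1) ≤ N ^ (p - 1) :=
          Real.rpow_le_rpow (abs_nonneg _) hNy (by linarith)
      _ ≤ N ^ (p - 1) * (((1 + ‖y‖) ^ (d + s * p))⁻¹ *
          ((1 / ε + 1) ^ (d + s * p) * ‖y‖ ^ (d + s * p))) := by
        refine le_mul_of_one_le_right (by positivity) ?_
        rw [← div_eq_inv_mul, le_div_iff₀ (by positivity), one_mul]
        exact h2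
      _ = _ := by ring

theorem setIntegral_annulus_fracIntegrand (hs : 0 < s) (hp : 1 < p) (hφ : MemLp φ ⊤ volume) {ε : ℝ}
    (hε : 0 < ε) (hεr : ε ≤ r) :
    ∫ y in (ball 0 ε)ᶜ, fracIntegrand s p φ z y = (∫ y in (ball 0 r)ᶜ, fracIntegrand s p φ z y) +
      (volume : Measure (EuclideanSpace ℝ (Fin d))).toSphere.real univ *
      ∫ t in Ico ε r, t ^ (-1 - s * p) * sphereAverage t fun y => J p (φ (z + y) - φ z) := by
  have hset : (ball (0 : EuclideanSpace ℝ (Fin d)) ε)ᶜ =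
      (ball 0 r)ᶜ ∪ {y : EuclideanSpace ℝ (Fin d) | ‖y‖ ∈ Ico ε r} := by
    ext y
    simp only [mem_compl_iff, mem_ball_zero_iff, not_lt, mem_union, mem_ofPred_eq, mem_Ico]
    constructor
    · intro h
      rcases le_or_gt r ‖y‖ with h' | h'
      exacts [.inl h', .inr ⟨h, h'⟩]
    · rintro (h | h)
      exacts [hεr.trans h, h.1]
  have hdisj : Disjoint (ball (0 : EuclideanSpace ℝ (Fin d)) r)ᶜ
      {y : EuclideanSpace ℝ (Fin d) | ‖y‖ ∈ Ico ε r} := by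
    rw [Set.disjoint_left]
    intro y hy hy'
    simp only [mem_compl_iff, mem_ball_zero_iff, not_lt] at hy
    exact hy'.2.not_ge hy
  have hm : MeasurableSet {y : EuclideanSpace ℝ (Fin d) | ‖y‖ ∈ Ico ε r} :=
    measurable_norm measurableSet_Ico
  have hi := integrableOn_fracIntegrand (z := z) hs hp hφ hε
  have hfun : ∀ y, fracIntegrand s p φ z y =
      (fun t : ℝ => (t ^ (d + s * p))⁻¹) ‖y‖ * J p (φ (z + y) - φ z) := fun y => by
    rw [fracIntegrand, div_eq_inv_mul]
  have hi2 := hi.mono_set (hset ▸ subset_union_right)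
  rw [hset, setIntegral_union hdisj hm (hi.mono_set (hset ▸ subset_union_left)) hi2]
  have hIco : Ioi 0 ∩ Ico ε r = Ico ε r := inter_eq_right.2 fun t ht => hε.trans_le ht.1
  have hi3 := hi2.congr_fun (fun y _ => hfun y) hm
  simp_rw [hfun]
  rw [setIntegral_norm_mem_eq (w := fun t : ℝ => (t ^ (d + s * p))⁻¹)
    (g := fun y => J p (φ (z + y) - φ z)) measurableSet_Ico hi3, hIco]
  congr 2
  refine setIntegral_congr_fun measurableSet_Ico fun t ht => ?_
  have ht0 : 0 < t := hε.trans_le ht.1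
  rw [← mul_assoc, ← Real.rpow_neg ht0.le, ← Real.rpow_natCast, ← Real.rpow_add ht0,
    Nat.cast_pred (NeZero.pos d)]
  congr 2
  ring

/-- Averaging over spheres first leaves a radial integrand O(t^(p-1-sp)), integrable at 0 since s <
1; hence the contribution of (0, ε) tends to 0. Every admissible r gives an expression for the same
limit. -/
theorem hasNegFracPLaplacian_of_sphereAverage {Λ C γ : ℝ} (hs : s ∈ Ioo (0 : ℝ) 1) (hp : 1 < p)
    (hγ : 0 ≤ γ) (hφ : MemLp φ ⊤ volume) (hr : 0 < r)
    (hint : IntegrableOn (fun y => J p (φ (z + y) - φ z)) (ball 0 r))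
    (h : ∀ t ∈ Ioo 0 r, |(sphereAverage t fun y => J p (φ (z + y) - φ z)) - Λ * t ^ p| ≤
      C * t ^ (p + γ)) :
    HasNegFracPLaplacian s p φ z ((∫ y in (ball 0 r)ᶜ, fracIntegrand s p φ z y) +
      (volume : Measure (EuclideanSpace ℝ (Fin d))).toSphere.real univ *
      ∫ t in Ioo 0 r, t ^ (-1 - s * p) * sphereAverage t fun y => J p (φ (z + y) - φ z)) := by
  refine ⟨fun ε hε => integrableOn_fracIntegrand hs.1 hp hφ hε, ?_⟩
  have hsp : 0 < p - s * p := by nlinarith [hs.2]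
  have hq : -1 < -1 - s * p + p := by linarith
  have hT := aestronglyMeasurable_sphereAverage hint
  have hI := integrableOn_rpow_mul hq hγ hT h
  set F : ℝ → ℝ := fun t => t ^ (-1 - s * p) * sphereAverage t fun y => J p (φ (z + y) - φ z)
  have hlim0 : Tendsto (fun ε => ∫ t in Ioo 0 ε, F t) (𝓝[>] 0) (𝓝 0) := by
    have hpow : ∀ a : ℝ, 0 < a → Tendsto (fun ε : ℝ => ε ^ a) (𝓝[>] 0) (𝓝 0) := fun a ha => by
      have := (Real.continuous_rpow_const ha.le).tendsto (0 : ℝ)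
      rw [Real.zero_rpow ha.ne'] at this
      exact this.mono_left nhdsWithin_le_nhds
    have h1 := ((hpow (-1 - s * p + p + 1) (by linarith)).div_const (-1 - s * p + p + 1)).const_mul Λ
    have h2 := ((hpow (-1 - s * p + p + γ + 1) (by linarith)).div_const
      (-1 - s * p + p + γ + 1)).const_mul C
    have h3 : Tendsto (fun ε => (∫ t in Ioo 0 ε, F t) -
        Λ * (ε ^ (-1 - s * p + p + 1) / (-1 - s * p + p + 1))) (𝓝[>] 0) (𝓝 0) := by
      rw [tendsto_zero_iff_abs_tendsto_zero]
      refine squeeze_zero' (.of_forall fun _ => abs_nonneg _) ?_ (by simpa using h2)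
      filter_upwards [Ioo_mem_nhdsGT hr] with ε hε
      exact abs_integral_rpow_mul_sub_le hq hγ hε.1
        (hT.mono_measure (Measure.restrict_mono (Ioo_subset_Ioo_right hε.2.le) le_rfl))
        fun t ht => h t ⟨ht.1, ht.2.trans hε.2⟩
    simpa using h3.add h1
  have hev : ∀ᶠ ε in 𝓝[>] (0 : ℝ), (∫ y in (ball 0 r)ᶜ, fracIntegrand s p φ z y) +
      (volume : Measure (EuclideanSpace ℝ (Fin d))).toSphere.real univ *
        ((∫ t in Ioo 0 r, F t) - ∫ t in Ioo 0 ε, F t) =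
      ∫ y in (ball 0 ε)ᶜ, fracIntegrand s p φ z y := by
    filter_upwards [Ioo_mem_nhdsGT hr] with ε hε
    rw [setIntegral_annulus_fracIntegrand hs.1 hp hφ hε.1 hε.2.le]
    have hsplit : ∫ t in Ioo 0 r, F t = (∫ t in Ioo 0 ε, F t) + ∫ t in Ico ε r, F t := by
      rw [← Ioo_union_Ico_eq_Ioo hε.1 hε.2.le, setIntegral_union _ measurableSet_Ico
        (hI.mono_set (Ioo_subset_Ioo_right hε.2.le))
        (hI.mono_set fun t ht => ⟨hε.1.trans_le ht.1, ht.2⟩)]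
      rw [Set.disjoint_left]
      exact fun t ht ht' => ht.2.not_ge ht'.1
    rw [hsplit, add_sub_cancel_left]
  refine Tendsto.congr' hev ?_
  have := ((hlim0.const_sub (∫ t in Ioo 0 r, F t)).const_mul
    ((volume : Measure (EuclideanSpace ℝ (Fin d))).toSphere.real univ)).const_add
    (∫ y in (ball 0 r)ᶜ, fracIntegrand s p φ z y)
  simpa using this

end Fractional

/-! ### Errors of the three means. -/

section Errors

variable {d : ℕ} [NeZero d] {s p r Λ C γ : ℝ} {φ : EuclideanSpace ℝ (Fin d) → ℝ}
  {z : EuclideanSpace ℝ (Fin d)}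

theorem abs_mul_meanSphere_sub_le (hp : 1 < p) (hr : 0 < r)
    (h : |(sphereAverage r fun y => J p (φ (z + y) - φ z)) - Λ * r ^ p| ≤ C * r ^ (p + γ)) :
    |kappa p d * Λ - meanSphere p r φ z| ≤ kappa p d * C * r ^ γ := by
  have hκ := kappa_pos (d := d) hp
  have hrp := Real.rpow_pos_of_pos hr p
  rw [meanSphere, abs_sub_comm]
  have e : kappa p d / r ^ p * (sphereAverage r fun y => J p (φ (z + y) - φ z)) - kappa p d * Λ =
      kappa p d / r ^ p * ((sphereAverage r fun y => J p (φ (z + y) - φ z)) - Λ * r ^ p) := by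
    field_simp
  rw [e, abs_mul, abs_of_pos (by positivity)]
  calc _ ≤ kappa p d / r ^ p * (C * r ^ (p + γ)) := by gcongr
    _ = _ := by rw [Real.rpow_add hr]; field_simp

theorem abs_mul_meanBall_sub_le (hp : 1 < p) (hγ : 0 ≤ γ) (hr : 0 < r) (hC : 0 ≤ C)
    (hint : IntegrableOn (fun y => J p (φ (z + y) - φ z)) (ball 0 r))
    (h : ∀ t ∈ Ioo 0 r, |(sphereAverage t fun y => J p (φ (z + y) - φ z)) - Λ * t ^ p| ≤
      C * t ^ (p + γ)) :
    |kappa p d * Λ - meanBall p r φ z| ≤ kappa p d * C * r ^ γ := by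
  have hκ := kappa_pos (d := d) hp
  have hd : (0 : ℝ) < d := Nat.cast_pos.2 (NeZero.pos d)
  have hrp := Real.rpow_pos_of_pos hr (p + d)
  have h1 := abs_integral_rpow_mul_sub_le (q := (d : ℝ) - 1) (by linarith) hγ hr
    (aestronglyMeasurable_sphereAverage hint) h
  rw [show (d : ℝ) - 1 + p + 1 = p + d by ring, show (d : ℝ) - 1 + p + γ + 1 = p + d + γ by ring]
    at h1
  have hpd : 0 < p + d := by linarith
  rw [meanBall_eq hr hint, abs_sub_comm]
  set I := ∫ t in Ioo 0 r, t ^ ((d : ℝ) - 1) * sphereAverage t fun y => J p (φ (z + y) - φ z)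
  have e : (p + d) * kappa p d / r ^ (p + d) * I - kappa p d * Λ =
      (p + d) * kappa p d / r ^ (p + d) * (I - Λ * (r ^ (p + d) / (p + d))) := by
    field_simp
  rw [e, abs_mul, abs_of_pos (by positivity)]
  calc _ ≤ (p + d) * kappa p d / r ^ (p + d) * (C * (r ^ (p + d + γ) / (p + d))) := by
        gcongr
        exact h1.trans (mul_le_mul_of_nonneg_left
          (div_le_div_of_nonneg_left (by positivity) hpd (by linarith)) hC)
    _ = _ := by rw [Real.rpow_add hr (p + d)]; field_simp

/-- The exterior integrals cancel. Inside B_r both terms have leading part σΛ r^(p(1-s))/(p(1-s)),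
with σ the total surface measure, which is what fixes the coefficient of the ball integral; the two
remainders account for the factor 2. -/
theorem abs_frac_sub_meanFrac_le (hs : s ∈ Ioo (0 : ℝ) 1) (hp : 1 < p) (hγ : 0 ≤ γ) (hr : 0 < r)
    (hC : 0 ≤ C)
    (hint : IntegrableOn (fun y => J p (φ (z + y) - φ z)) (ball 0 r))
    (h : ∀ t ∈ Ioo 0 r, |(sphereAverage t fun y => J p (φ (z + y) - φ z)) - Λ * t ^ p| ≤
      C * t ^ (p + γ)) :
    |((∫ y in (ball 0 r)ᶜ, fracIntegrand s p φ z y) +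
      (volume : Measure (EuclideanSpace ℝ (Fin d))).toSphere.real univ *
      ∫ t in Ioo 0 r, t ^ (-1 - s * p) * sphereAverage t fun y => J p (φ (z + y) - φ z)) -
      meanFrac s p r φ z| ≤
    2 * (volume : Measure (EuclideanSpace ℝ (Fin d))).toSphere.real univ * C / (p * (1 - s)) *
      r ^ (γ + p * (1 - s)) := by
  set σ := (volume : Measure (EuclideanSpace ℝ (Fin d))).toSphere.real univ
  have hσ : 0 < σ := toSphere_real_univ_pos
  have hd : (0 : ℝ) < d := Nat.cast_pos.2 (NeZero.pos d)
  have hT := aestronglyMeasurable_sphereAverage hint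
  have hs1 : 0 < 1 - s := by linarith [hs.2]
  have ha : 0 < p * (1 - s) := by positivity
  have h1 := abs_integral_rpow_mul_sub_le (q := (d : ℝ) - 1) (by linarith) hγ hr hT h
  have h2 := abs_integral_rpow_mul_sub_le (q := -1 - s * p) (by nlinarith) hγ hr hT h
  rw [show (d : ℝ) - 1 + p + 1 = p + d by ring, show (d : ℝ) - 1 + p + γ + 1 = p + d + γ by ring]
    at h1
  rw [show -1 - s * p + p + 1 = p * (1 - s) by ring,
    show -1 - s * p + p + γ + 1 = p * (1 - s) + γ by ring] at h2
  rw [meanFrac, setIntegral_ball_eq hint]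
  set I := ∫ t in Ioo 0 r, t ^ ((d : ℝ) - 1) * sphereAverage t fun y => J p (φ (z + y) - φ z)
  set I' := ∫ t in Ioo 0 r, t ^ (-1 - s * p) * sphereAverage t fun y => J p (φ (z + y) - φ z)
  have hrq := Real.rpow_pos_of_pos hr (d + s * p)
  have hra := Real.rpow_pos_of_pos hr (p * (1 - s))
  have hpd : 0 < p + d := by linarith
  have epd : r ^ (p + d) = r ^ (d + s * p) * r ^ (p * (1 - s)) := by
    rw [← Real.rpow_add hr]
    ring_nf
  have e : (∫ y in (ball 0 r)ᶜ, fracIntegrand s p φ z y) + σ * I' -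
      ((p + d) / (p * (1 - s) * r ^ (d + s * p)) * (σ * I) +
        ∫ y in (ball 0 r)ᶜ, fracIntegrand s p φ z y) =
      σ * ((I' - Λ * (r ^ (p * (1 - s)) / (p * (1 - s)))) -
        (p + d) / (p * (1 - s) * r ^ (d + s * p)) * (I - Λ * (r ^ (p + d) / (p + d)))) := by
    rw [epd]
    field_simp
    ring
  rw [e, abs_mul, abs_of_pos hσ]
  have b1 : |I' - Λ * (r ^ (p * (1 - s)) / (p * (1 - s)))| ≤
      C * (r ^ (p * (1 - s) + γ) / (p * (1 - s))) := by
    refine h2.trans ?_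
    gcongr
    linarith
  have b2 : |(p + d) / (p * (1 - s) * r ^ (d + s * p)) * (I - Λ * (r ^ (p + d) / (p + d)))| ≤
      C * (r ^ (p * (1 - s) + γ) / (p * (1 - s))) := by
    rw [abs_mul, abs_of_pos (by positivity)]
    calc _ ≤ (p + d) / (p * (1 - s) * r ^ (d + s * p)) * (C * (r ^ (p + d + γ) / (p + d))) := by
          gcongr
          exact h1.trans (mul_le_mul_of_nonneg_left
            (div_le_div_of_nonneg_left (by positivity) hpd (by linarith)) hC)
      _ = _ := by
        rw [Real.rpow_add hr (p + d), Real.rpow_add hr (p * (1 - s)), epd]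
        field_simp
  calc _ ≤ σ * (C * (r ^ (p * (1 - s) + γ) / (p * (1 - s))) +
        C * (r ^ (p * (1 - s) + γ) / (p * (1 - s)))) := by
        gcongr
        exact (abs_sub _ _).trans (add_le_add b1 b2)
    _ = _ := by
      rw [add_comm γ]
      ring

end Errors

/-! ### Bounds uniform in the base point. -/

section Assembly

variable {d : ℕ} [NeZero d]

omit [NeZero d] in
theorem Rtilde_le {φ : EuclideanSpace ℝ (Fin d) → ℝ} {x : EuclideanSpace ℝ (Fin d)} {R : ℝ}
    (hR : 0 < R) : Rtilde φ x R ≤ R / 2 :=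
  ENNReal.toReal_le_of_le_ofReal (by positivity) (min_le_right _ _)

omit [NeZero d] in
theorem exists_gradient_lower_bound {φ : EuclideanSpace ℝ (Fin d) → ℝ}
    {x : EuclideanSpace ℝ (Fin d)} {R : ℝ} (hR : 0 < R) (hφ : ContDiffOn ℝ 4 φ (ball x R))
    (hgrad : ∀ z ∈ closedBall x R, extendFrom (ball x R) (gradient φ) z ≠ 0) :
    ∃ c, 0 < c ∧ ∀ z ∈ closedBall x (R / 4), c ≤ ‖gradient φ z‖ := by
  have hsub : closedBall x (R / 4) ⊆ ball x R := closedBall_subset_ball (by linarith)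
  have hcont : ∀ z ∈ ball x R, ContinuousAt (gradient φ) z := fun z hz => by
    obtain ⟨H, hH, -⟩ := exists_hasFDerivAt_gradient hφ isOpen_ball hz
    exact hH.continuousAt
  obtain ⟨z₀, hz₀, hmin⟩ := (isCompact_closedBall x (R / 4)).exists_isMinOn
    ⟨x, mem_closedBall_self (by positivity)⟩
    (fun z hz => (hcont z (hsub hz)).norm.continuousWithinAt)
  refine ⟨‖gradient φ z₀‖, ?_, fun z hz => hmin hz⟩
  have h1 := hgrad z₀ (ball_subset_closedBall (hsub hz₀))
  -- At interior points the continuous extension of the gradient is the gradient itself.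
  rw [extendFrom_eq (subset_closure (hsub hz₀))
    ((hcont z₀ (hsub hz₀)).tendsto.mono_left nhdsWithin_le_nhds)] at h1
  exact norm_pos_iff.2 h1

omit [NeZero d] in
theorem exists_iteratedFDeriv_bound {φ : EuclideanSpace ℝ (Fin d) → ℝ}
    {Ω : Set (EuclideanSpace ℝ (Fin d))} {k : ℕ} (hφ : IsCb k φ Ω) :
    ∃ M, ∀ j ≤ k, ∀ z ∈ Ω, ‖iteratedFDeriv ℝ j φ z‖ ≤ M := by
  choose! C hC using hφ.2
  refine ⟨∑ j ∈ Finset.range (k + 1), |C j|, fun j hj z hz => (hC j hj z hz).trans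
    ((le_abs_self _).trans ?_)⟩
  exact Finset.single_le_sum (f := fun j => |C j|) (fun _ _ => abs_nonneg _)
    (Finset.mem_range.2 (Nat.lt_succ_of_le hj))

theorem AdmissibleOrder.nonneg {p γ : ℝ} (h : AdmissibleOrder p γ) : 0 ≤ γ := by
  rcases h with ⟨-, rfl⟩ | ⟨-, h⟩ | ⟨-, h⟩
  · norm_num
  · linarith [h.1]
  · exact h.1.le

omit [NeZero d] in
theorem integrableOn_ball_J {p : ℝ} (hp : 1 < p) {φ : EuclideanSpace ℝ (Fin d) → ℝ}
    {z : EuclideanSpace ℝ (Fin d)} {r : ℝ} (hφ : ContinuousOn φ (closedBall z r)) :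
    IntegrableOn (fun y => J p (φ (z + y) - φ z)) (ball 0 r) := by
  refine IntegrableOn.mono_set ?_ ball_subset_closedBall
  refine ContinuousOn.integrableOn_compact (isCompact_closedBall _ _) ?_
  refine (continuous_J hp).comp_continuousOn (ContinuousOn.sub ?_ continuousOn_const)
  refine hφ.comp (by fun_prop) fun y hy => ?_
  simpa using hy

end Assembly

end PLaplaceExpansion

end

/-! ### The theorem. -/

open PLaplaceExpansion in
theorem theorem2p3 {d : ℕ} [NeZero d] (hd : 2 ≤ d) (p : ℝ) (hp : 1 < p)
    (s : ℝ) (hs : s ∈ Set.Ioo (0 : ℝ) 1)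
    (x : EuclideanSpace ℝ (Fin d)) (R : ℝ) (hR : 0 < R) (hR1 : R < 1)
    (φ : EuclideanSpace ℝ (Fin d) → ℝ) (hφ : IsCb 4 φ (Metric.ball x R))
    -- the continuous extension of the gradient to the closed ball does not vanish
    (hgrad : ∀ z ∈ Metric.closedBall x R, extendFrom (Metric.ball x R) (gradient φ) z ≠ 0)
    (γ : ℝ) (hγ : AdmissibleOrder p γ) :
    (∃ C : ℝ, ∀ r : ℝ, 0 < r → r < Rtilde φ x R →
      ∀ z ∈ Metric.ball x (Rtilde φ x R / 2),
        |pLaplacian p φ z - meanSphere p r φ z| ≤ C * r ^ γ ∧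
        |pLaplacian p φ z - meanBall p r φ z| ≤ C * r ^ γ) ∧
    (MeasureTheory.MemLp φ ⊤ MeasureTheory.volume →
      ∃ L : EuclideanSpace ℝ (Fin d) → ℝ,
        (∀ z ∈ Metric.ball x (Rtilde φ x R / 2), HasNegFracPLaplacian s p φ z (L z)) ∧
        ∃ C : ℝ, ∀ r : ℝ, 0 < r → r < Rtilde φ x R →
          ∀ z ∈ Metric.ball x (Rtilde φ x R / 2),
            |L z - meanFrac s p r φ z| ≤ C * r ^ (γ + p * (1 - s))) := by
  obtain ⟨c, hc, hlow⟩ := exists_gradient_lower_bound hR hφ.1 hgrad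
  obtain ⟨M, hM⟩ := exists_iteratedFDeriv_bound hφ
  obtain ⟨C, hC, hest⟩ := exists_sphere_estimate hp hγ hφ.1 isOpen_ball hM hc
  -- This places z in B_{R/4}(x) and r below R/2, so the closed ball of radius r about z stays
  -- inside B_R(x).
  have hRt : Rtilde φ x R ≤ R / 2 := Rtilde_le hR
  have hκ := kappa_pos (d := d) hp
  have hz4 : ∀ z ∈ ball x (Rtilde φ x R / 2), z ∈ ball x (R / 4) := fun z hz =>
    ball_subset_ball (by linarith) hz
  have hsub : ∀ z ∈ ball x (R / 4), ∀ r < R / 2, closedBall z r ⊆ ball x R := fun z hz r hr =>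
    closedBall_subset_ball' (by rw [mem_ball] at hz; linarith)
  have hint : ∀ z ∈ ball x (R / 4), ∀ r < R / 2,
      IntegrableOn (fun y => J p (φ (z + y) - φ z)) (ball 0 r) := fun z hz r hr =>
    integrableOn_ball_J hp (hφ.1.continuousOn.mono (hsub z hz r hr))
  have hS : ∀ z ∈ ball x (R / 4), ∀ t, 0 < t → t < R / 2 →
      |(sphereAverage t fun y => J p (φ (z + y) - φ z)) - pLaplacian p φ z / kappa p d * t ^ p| ≤
        C * t ^ (p + γ) := fun z hz t ht ht2 => by
    have := hest z t ht (by linarith) (hsub z hz t ht2) (hlow z (ball_subset_closedBall hz))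
    rwa [mul_comm (t ^ p)] at this
  refine ⟨⟨kappa p d * C, fun r hr hrR z hz => ?_⟩, fun hφb => ?_⟩
  · have hz' := hz4 z hz
    have hr2 : r < R / 2 := hrR.trans_le hRt
    have e : pLaplacian p φ z = kappa p d * (pLaplacian p φ z / kappa p d) := by field_simp
    rw [e]
    exact ⟨abs_mul_meanSphere_sub_le hp hr (hS z hz' r hr hr2),
      abs_mul_meanBall_sub_le hp hγ.nonneg hr hC (hint z hz' r hr2) fun t ht =>
        hS z hz' t ht.1 (ht.2.trans hr2)⟩
  · have hfrac : ∀ z ∈ ball x (R / 4), ∀ r, 0 < r → r < R / 2 →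
        HasNegFracPLaplacian s p φ z _ := fun z hz r hr hr2 =>
      hasNegFracPLaplacian_of_sphereAverage hs hp hγ.nonneg hφb hr (hint z hz r hr2) fun t ht =>
        hS z hz t ht.1 (ht.2.trans hr2)
    -- The value is chosen as the limit itself, independently of r; uniqueness of limits then
    -- identifies it with the expression attached to each r.
    refine ⟨fun z => limUnder (𝓝[>] 0) fun ε : ℝ =>
      ∫ y in (ball (0 : EuclideanSpace ℝ (Fin d)) ε)ᶜ, fracIntegrand s p φ z y,
      fun z hz => ?_, 2 * (volume : Measure (EuclideanSpace ℝ (Fin d))).toSphere.real univ * C /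
        (p * (1 - s)), fun r hr hrR z hz => ?_⟩
    · beta_reduce
      have := hfrac z (hz4 z hz) (R / 4) (by linarith) (by linarith)
      rwa [this.2.limUnder_eq]
    · beta_reduce
      have hz' := hz4 z hz
      have hr2 : r < R / 2 := hrR.trans_le hRt
      rw [(hfrac z hz' r hr hr2).2.limUnder_eq]
      exact abs_frac_sub_meanFrac_le hs hp hγ.nonneg hr hC (hint z hz' r hr2) fun t ht =>
        hS z hz' t ht.1 (ht.2.trans hr2)
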